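/- Let $E$ be a real or complex Banach lattice with positive cone $E_+$. Let $Z(E)$ denote its (ideal) center, i.e. the set of all bounded linear operators $T$ on $E$ for which there is $M>0$ such that $|T(x)|\le Mx$ for all $x\in E_+$; $Z(E)$ is itself a (real, respectively complex) vector lattice whose positive elements are the operators in $Z(E)$ that map $E_+$ into $E_+$, and for $T\in Z(E)$ we write $|T|$ for its absolute value in this lattice and $1$ for the identity operator. (a) Let $W$ be a cone in $E$ with the properties: 1. $E$ is a Banach lattice with the cone $W$ and with its original norm; 2. $E$ has the same closed ideals with respect to the cones $E_+$ and $W$ (a closed ideal being a closed linear subspace $J$ such that $x\in J$ and $|y|\le|x|$ imply $y\in J$, where the absolute value and the order are those of the cone considered). Then there is $T\in Z(E)$ with $|T|=1$ such that $T(x)=|x|_W$ for every $x\in E_+$, where $|\cdot|_W$ denotes the absolute value with respect to the lattice structure given by the cone $W$. (b) Conversely, if $T\in Z(E)$ and $|T|=1$, then $W=T(E_+)$ is a cone in $E$ for which properties 1 and 2 hold. -/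

import Mathlib

/-!
Real (`𝕜 = ℝ`) and complex (`𝕜 = ℂ`) Banach lattices are treated together. The order is carried by
its positive cone `W`, a subset of the space, with `x ≤ y` meaning `y - x ∈ W`, so that a space can
be given several orders at once. In the complex case the self-conjugate ("real") vectors are those
of `W - W`, and the space is the complexification of `W - W`.
-/

section Order

variable (𝕜 : Type*) [RCLike 𝕜] {V : Type*} [AddCommGroup V] [Module 𝕜 V]

/-- `W` is a (proper, convex) cone: `W + W ⊆ W`, `r W ⊆ W` for real `r ≥ 0`, `W ∩ (-W) = {0}`. -/
structure IsCone (W : Set V) : Prop where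
  zero_mem : (0 : V) ∈ W
  add_mem : ∀ x ∈ W, ∀ y ∈ W, x + y ∈ W
  smul_mem : ∀ r : ℝ, 0 ≤ r → ∀ x ∈ W, (r : 𝕜) • x ∈ W
  salient : ∀ x ∈ W, -x ∈ W → x = 0

/-- The order defined by `W`. -/
def ConeLE (W : Set V) (x y : V) : Prop := y - x ∈ W

/-- The real vectors `W - W`. -/
def realVectors (W : Set V) : Set V := {x | ∃ a ∈ W, ∃ b ∈ W, x = a - b}

/-- `s` is the supremum of the set `A` in the order defined by `W`. -/
def IsConeSup (W A : Set V) (s : V) : Prop :=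
  (∀ x ∈ A, ConeLE W x s) ∧ ∀ t, (∀ x ∈ A, ConeLE W x t) → ConeLE W s t

/-- The real parts of `c z`, where `c` runs through the scalars of modulus one. For `𝕜 = ℝ`
(where `RCLike.I = 0`) these are just `z` and `-z`. -/
def rotatedRealParts (W : Set V) (z : V) : Set V :=
  {x | x ∈ realVectors W ∧
    ∃ c : 𝕜, ‖c‖ = 1 ∧ ∃ y ∈ realVectors W, c • z = x + (RCLike.I : 𝕜) • y}

/-- `m` is the absolute value `|z|` of `z` in the order defined by `W`: `|z| = sup {z, -z}` for
`𝕜 = ℝ`, and `|z| = sup {Re (c z) : |c| = 1}` for `𝕜 = ℂ`. -/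
def IsModulus (W : Set V) (z m : V) : Prop := IsConeSup W (rotatedRealParts 𝕜 W z) m

end Order

section BanachLattice

variable (𝕜 : Type*) [RCLike 𝕜] {E : Type*} [NormedAddCommGroup E] [NormedSpace 𝕜 E]

/-- The Banach space `E` (completeness is assumed separately) with the positive cone `W` and its
given norm is a Banach lattice over `𝕜`. -/
structure IsBanachLatticeCone (W : Set E) : Prop where
  isCone : IsCone 𝕜 W
  /-- `E = (W - W) + i (W - W)`; this reads `E = W - W` for `𝕜 = ℝ`. -/
  exists_real_imag : ∀ z : E, ∃ x ∈ realVectors W, ∃ y ∈ realVectors W,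
    z = x + (RCLike.I : 𝕜) • y
  /-- `(W - W) ∩ i (W - W) = {0}`; this is trivial for `𝕜 = ℝ`. -/
  real_inf_imag : ∀ x ∈ realVectors W, (RCLike.I : 𝕜) • x ∈ realVectors W →
    (RCLike.I : 𝕜) • x = 0
  /-- The real vectors form a lattice. -/
  exists_sup : ∀ x ∈ realVectors W, ∀ y ∈ realVectors W, ∃ s, IsConeSup W {x, y} s
  /-- Every vector has an absolute value, of the same norm. -/
  exists_modulus : ∀ z : E, ∃ m, IsModulus 𝕜 W z m ∧ ‖m‖ = ‖z‖
  /-- The norm is monotone on the positive cone. -/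
  norm_mono : ∀ x ∈ W, ∀ y ∈ W, ConeLE W x y → ‖x‖ ≤ ‖y‖

/-- `J` is a closed (order) ideal: a closed linear subspace such that `x ∈ J` and `|y| ≤ |x|`
imply `y ∈ J`. -/
def IsClosedIdeal (W : Set E) (J : Submodule 𝕜 E) : Prop :=
  IsClosed (J : Set E) ∧
    ∀ x ∈ J, ∀ y mx my : E, IsModulus 𝕜 W x mx → IsModulus 𝕜 W y my → ConeLE W my mx → y ∈ J

/-- The ideal center `Z(E)`: the bounded operators `T` for which there is `M > 0` such that
`|T x| ≤ M x` for all `x ≥ 0`. -/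
def idealCenter (W : Set E) : Set (E →L[𝕜] E) :=
  {T | ∃ M : ℝ, 0 < M ∧ ∀ x ∈ W, ∃ m, IsModulus 𝕜 W (T x) m ∧ ConeLE W m ((M : 𝕜) • x)}

/-- The positive cone `Z(E)₊` of the ideal center: its operators that map `W` into `W`. The absolute
value of `T ∈ Z(E)` in the lattice `Z(E)` is its absolute value with respect to this cone. -/
def centerCone (W : Set E) : Set (E →L[𝕜] E) :=
  {S | S ∈ idealCenter 𝕜 W ∧ ∀ x ∈ W, S x ∈ W}

end BanachLattice

/-! ### Disjointness and scaling in lattice-ordered groups. -/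

section LatticeOrderedGroup

/-! The guiding picture: `T` in the center with `|T| = 1` is multiplication by a unimodular
function. No representation is used; local order arguments replace it. For `T` in the center, `|T| =
1` means `|T x| = x` for all `x ≥ 0` (`isModulus_one_iff`).

For (a), disjoint complements are closed ideals, so vectors disjoint for `E₊` are disjoint for `W`.
The map sending `x` to `|x|_W` is sublinear, satisfies the reverse triangle inequality and preserves
disjointness. Such a bounded map is additive (`map_add_of_disjointness_preserving`): its additivity
defect at `x, y` is dominated by twice its value at a vector below `(x + y)/n`, for every `n`. Hence
it extends to an operator `T`. The map sending `x` to `|T x|` is again additive, and it is positive,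
isometric and band preserving; such a map is the identity (`map_eq_self_of_band_preserving`), since
exceeding or undercutting `x` by a factor somewhere would change a norm.

For (b), below every nonzero positive vector lies a nonzero order interval on which `T` is within
`δ` of a unimodular scalar (`exists_mod_smul_map_sub_le`). Checking on such intervals yields `|T z|
≤ |z|` for all `z`, and shows that the operator equal to the conjugate of `T x` on `E₊` inverts `T`.
So `T` is a bijection preserving `|·|`, hence the norm; it carries the lattice structure to `T(E₊)`
and maps every closed ideal onto itself. -/

theorem eq_zero_of_le_of_inf_eq_zero {X : Type*} [AddCommGroup X] [Lattice X] {a b c : X}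
    (ha : 0 ≤ a) (hb : a ≤ b) (hc : a ≤ c) (h : b ⊓ c = 0) : a = 0 :=
  le_antisymm (h ▸ le_inf hb hc) ha

theorem inf_eq_zero_of_le {X : Type*} [AddCommGroup X] [Lattice X] {a b c d : X}
    (ha : 0 ≤ a) (hb : 0 ≤ b) (hac : a ≤ c) (hbd : b ≤ d) (h : c ⊓ d = 0) : a ⊓ b = 0 :=
  le_antisymm (h ▸ inf_le_inf hac hbd) (le_inf ha hb)

variable {X : Type*} [AddCommGroup X] [Lattice X] [IsOrderedAddMonoid X]

theorem add_inf_le_of_nonneg {a b c : X} (ha : 0 ≤ a) (hb : 0 ≤ b) (hc : 0 ≤ c) :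
    (a + b) ⊓ c ≤ a ⊓ c + b ⊓ c := by
  rw [add_inf, inf_add, inf_add]
  refine le_inf (le_inf inf_le_left ?_) (le_inf ?_ ?_)
  · exact inf_le_right.trans (le_add_of_nonneg_right hb)
  · exact inf_le_right.trans (le_add_of_nonneg_left ha)
  · exact inf_le_right.trans (le_add_of_nonneg_left hc)

theorem add_inf_eq_zero {a b c : X} (ha : 0 ≤ a) (hb : 0 ≤ b) (hc : 0 ≤ c)
    (hac : a ⊓ c = 0) (hbc : b ⊓ c = 0) : (a + b) ⊓ c = 0 := by
  refine le_antisymm ?_ (le_inf (add_nonneg ha hb) hc)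
  simpa [hac, hbc] using add_inf_le_of_nonneg ha hb hc

theorem posPart_sub_inf_posPart_sub (a b : X) : (a - b)⁺ ⊓ (b - a)⁺ = 0 := by
  have := posPart_inf_negPart_eq_zero (a - b)
  rwa [← posPart_neg, neg_sub] at this

theorem sub_inf_eq_posPart_sub (a b : X) : a - a ⊓ b = (a - b)⁺ := by
  rw [inf_eq_sub_posPart_sub, sub_sub_cancel]

theorem add_sub_abs_sub_eq_two_nsmul_inf (a b : X) : a + b - |a - b| = 2 • (a ⊓ b) := by
  have h1 := inf_eq_sub_posPart_sub a b
  have h2 : |a - b| = (a - b)⁺ + (a - b)⁻ := (posPart_add_negPart _).symm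
  have h3 : (a - b)⁺ - (a - b)⁻ = a - b := posPart_sub_negPart _
  rw [h1, h2, sub_eq_iff_eq_add.1 h3, two_nsmul]; abel

theorem abs_sub_le_abs_add_abs (a b : X) : |a - b| ≤ |a| + |b| := by
  rw [sub_eq_add_neg, ← abs_neg b]; exact abs_add_le _ _

/-- With `t` the infimum, `t ≤ (a - n • t)⁺`, so `t`, and with it `n • t`, is disjoint from `(n • t
- a)⁺`. That vector lies below `n • t`, so it vanishes. -/
theorem inf_posPart_sub_nsmul_le {a y : X} (ha : 0 ≤ a) (hy : 0 ≤ y) (n : ℕ) :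
    n • (y ⊓ (a - n • y)⁺) ≤ a := by
  set t := y ⊓ (a - n • y)⁺ with ht
  have ht0 : 0 ≤ t := le_inf hy (posPart_nonneg _)
  have hle : n • t ≤ n • y := nsmul_le_nsmul_right inf_le_left n
  have h1 : t ≤ (a - n • t)⁺ := inf_le_right.trans (posPart_mono (sub_le_sub_left hle a))
  have h2 : t ⊓ (n • t - a)⁺ = 0 :=
    inf_eq_zero_of_le ht0 (posPart_nonneg _) h1 le_rfl (posPart_sub_inf_posPart_sub _ _)
  have h3 : ∀ k : ℕ, (k • t) ⊓ (n • t - a)⁺ = 0 := by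
    intro k
    induction k with
    | zero => simp
    | succ k ih =>
      rw [succ_nsmul]
      exact add_inf_eq_zero (nsmul_nonneg ht0 k) ht0 (posPart_nonneg _) ih h2
  have h4 : (n • t - a)⁺ = 0 :=
    eq_zero_of_le_of_inf_eq_zero (posPart_nonneg _)
      (sup_le (sub_le_self _ ha) (nsmul_nonneg ht0 n)) le_rfl (h3 n)
  exact sub_nonpos.1 (posPart_eq_zero.1 h4)

theorem abs_smul_of_nonneg [Module ℝ X] [IsOrderedModule ℝ X] {r : ℝ} (hr : 0 ≤ r) (a : X) :
    |r • a| = r • |a| := by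
  have key : ∀ (s : ℝ) (b : X), 0 ≤ s → |s • b| ≤ s • |b| := fun s b hs =>
    abs_le'.2 ⟨smul_le_smul_of_nonneg_left (le_abs_self b) hs, by
      rw [← smul_neg]; exact smul_le_smul_of_nonneg_left (neg_le_abs b) hs⟩
  rcases hr.eq_or_lt with rfl | hr
  · simp
  refine le_antisymm (key r a hr.le) ?_
  have := smul_le_smul_of_nonneg_left (key r⁻¹ (r • a) (by positivity)) hr.le
  rwa [smul_smul, smul_smul, inv_mul_cancel₀ hr.ne', mul_inv_cancel₀ hr.ne', one_smul,
    one_smul] at this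

theorem smul_inf_eq_zero [Module ℝ X] [IsOrderedModule ℝ X] {r : ℝ} (hr : 0 ≤ r) {x y : X}
    (hx : 0 ≤ x) (hy : 0 ≤ y) (hxy : x ⊓ y = 0) : (r • x) ⊓ y = 0 := by
  obtain ⟨n, hn⟩ := exists_nat_gt r
  refine inf_eq_zero_of_le (c := n • x) (smul_nonneg hr hx) hy ?_ le_rfl ?_
  · rw [← Nat.cast_smul_eq_nsmul ℝ]
    exact smul_le_smul_of_nonneg_right hn.le hx
  · clear hn
    induction n with
    | zero => simpa using hy
    | succ n ih =>
      rw [succ_nsmul]; exact add_inf_eq_zero (nsmul_nonneg hx n) hx hy ih hxy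

theorem map_nsmul_of_add {Z : Type*} [AddCommGroup Z] {A : X → Z}
    (hadd : ∀ x y, 0 ≤ x → 0 ≤ y → A (x + y) = A x + A y) (n : ℕ) {x : X} (hx : 0 ≤ x) :
    A (n • x) = n • A x := by
  induction n with
  | zero => simpa using hadd 0 0 le_rfl le_rfl
  | succ n ih => rw [succ_nsmul, hadd _ _ (nsmul_nonneg hx n) hx, ih, succ_nsmul]

end LatticeOrderedGroup

/-! ### Additivity of disjointness preserving maps. -/

section NormedLattice

variable {X Y : Type*} [NormedAddCommGroup X] [Lattice X] [HasSolidNorm X] [IsOrderedAddMonoid X]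
  [NormedAddCommGroup Y] [Lattice Y] [HasSolidNorm Y] [IsOrderedAddMonoid Y]

/-- A sublinear, bounded, disjointness preserving map that satisfies the reverse triangle
inequality is additive on the positive cone. -/
theorem map_add_of_disjointness_preserving [NormedSpace ℝ X] [IsOrderedModule ℝ X]
    {N : X → Y} {C : ℝ}
    (hsub : ∀ x y, 0 ≤ x → 0 ≤ y → N (x + y) ≤ N x + N y)
    (hrev : ∀ x y, 0 ≤ x → 0 ≤ y → N x ≤ N (x + y) + N y)
    (hsmul : ∀ (n : ℕ) x, 0 ≤ x → N (n • x) = n • N x)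
    (hdis : ∀ x y, 0 ≤ x → 0 ≤ y → x ⊓ y = 0 → N x ⊓ N y = 0)
    (hbd : ∀ x, 0 ≤ x → ‖N x‖ ≤ C * ‖x‖) {x y : X} (hx : 0 ≤ x) (hy : 0 ≤ y) :
    N (x + y) = N x + N y := by
  have hzero : N 0 = 0 := by simpa using hsmul 0 0 le_rfl
  -- The reverse triangle inequality, used for both `p` and `q`, gives `|N p - N q| ≤ N (p + q)`.
  have hdefect : ∀ p q, 0 ≤ p → 0 ≤ q → N p + N q - N (p + q) ≤ 2 • (N p ⊓ N q) := by
    intro p q hp hq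
    rw [← add_sub_abs_sub_eq_two_nsmul_inf]
    refine sub_le_sub_left (abs_le'.2 ⟨?_, ?_⟩) _
    · rw [sub_le_iff_le_add]; exact hrev p q hp hq
    · rw [neg_sub, sub_le_iff_le_add, add_comm p q]; exact hrev q p hq hp
  have hadd : ∀ p q, 0 ≤ p → 0 ≤ q → p ⊓ q = 0 → N (p + q) = N p + N q := by
    intro p q hp hq h
    refine le_antisymm (hsub p q hp hq) ?_
    have := hdefect p q hp hq
    rw [hdis p q hp hq h, smul_zero, sub_nonpos] at this
    exact this
  -- Removing `p ⊓ q` from both vectors leaves disjoint remainders, whose images are disjoint.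
  have hinf : ∀ p q, 0 ≤ p → 0 ≤ q → N p ⊓ N q ≤ N (p ⊓ q) := by
    intro p q hp hq
    have hm : 0 ≤ p ⊓ q := le_inf hp hq
    have hp1 : 0 ≤ p - p ⊓ q := sub_nonneg.2 inf_le_left
    have hq1 : 0 ≤ q - p ⊓ q := sub_nonneg.2 inf_le_right
    have hd : (p - p ⊓ q) ⊓ (q - p ⊓ q) = 0 := by rw [← inf_sub, sub_self]
    have h1 : N p ≤ N (p ⊓ q) + N (p - p ⊓ q) := by
      simpa using hsub _ _ hm hp1
    have h2 : N q ≤ N (p ⊓ q) + N (q - p ⊓ q) := by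
      simpa using hsub _ _ hm hq1
    calc N p ⊓ N q ≤ _ := inf_le_inf h1 h2
      _ = N (p ⊓ q) := by rw [← add_inf, hdis _ _ hp1 hq1 hd, add_zero]
  have hsum : ∀ (n : ℕ) (f : ℕ → X), (∀ k, 0 ≤ f k) →
      N (∑ k ∈ Finset.range n, f k) ≤ ∑ k ∈ Finset.range n, N (f k) := by
    intro n f hf
    induction n with
    | zero => simp [hzero]
    | succ n ih =>
      rw [Finset.sum_range_succ, Finset.sum_range_succ]
      exact (hsub _ _ (Finset.sum_nonneg fun i _ => hf i) (hf n)).trans (by gcongr)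
  set d := N x + N y - N (x + y) with hd
  have hd0 : 0 ≤ d := sub_nonneg.2 (hsub x y hx hy)
  have key : ∀ n : ℕ, 0 < n → ‖d‖ ≤ (2 * |C| * ‖x + y‖) * (n : ℝ)⁻¹ := by
    intro n hn
    -- The sum `x + y` is cut into `n` equal pieces `v`. Of the piece numbered `k`, the share `a k`
    -- goes to `x` and `v - a k` to `y`.
    set v : X := (n : ℝ)⁻¹ • (x + y) with hv
    have hv0 : 0 ≤ v := smul_nonneg (by positivity) (add_nonneg hx hy)
    have hnv : n • v = x + y := by
      rw [hv, ← Nat.cast_smul_eq_nsmul ℝ, smul_smul, mul_inv_cancel₀ (by positivity), one_smul]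
    set a : ℕ → X := fun k => x ⊓ ((k + 1) • v) - x ⊓ (k • v) with ha
    have ha0 : ∀ k, 0 ≤ a k := fun k => sub_nonneg.2 (inf_le_inf le_rfl
      (by rw [succ_nsmul]; exact le_add_of_nonneg_right hv0))
    have hav : ∀ k, a k ≤ v := fun k => by
      rw [ha, sub_le_iff_le_add, add_inf]
      exact le_inf (inf_le_left.trans (le_add_of_nonneg_left hv0))
        (inf_le_right.trans (by rw [succ_nsmul, add_comm]))
    have ha_le : ∀ k, a k ≤ (x - k • v)⁺ := fun k => by
      rw [← sub_inf_eq_posPart_sub]; exact sub_le_sub_right inf_le_left _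
    have hb_le : ∀ k, v - a k ≤ ((k + 1) • v - x)⁺ := fun k => by
      rw [← sub_inf_eq_posPart_sub, inf_comm, ha, sub_sub_eq_add_sub, succ_nsmul, add_comm v]
      exact sub_le_sub_right (add_le_add_left inf_le_right _) _
    have hb0 : ∀ k, 0 ≤ v - a k := fun k => sub_nonneg.2 (hav k)
    -- Twice `N (m k)` bounds the defect of piece `k`. The `m k` are disjoint: for `k < l` one lies
    -- below `((k + 1) • v - x)⁺`, the other below `(x - (k + 1) • v)⁺`.
    set m : ℕ → X := fun k => a k ⊓ (v - a k) with hm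
    have hm0 : ∀ k, 0 ≤ m k := fun k => le_inf (ha0 k) (hb0 k)
    have hmdis : ∀ k l, k < l → m k ⊓ m l = 0 := fun k l hkl => by
      refine inf_eq_zero_of_le (hm0 k) (hm0 l) (inf_le_right.trans (hb_le k))
        ((inf_le_left.trans (ha_le l)).trans (posPart_mono (sub_le_sub_left
          (nsmul_le_nsmul_left hv0 hkl) x))) ?_
      rw [inf_comm]
      exact posPart_sub_inf_posPart_sub _ _
    -- Disjoint vectors have their supremum as sum, so the sum of all `m i` stays below the single
    -- piece `v`; this produces the factor `1 / n`.
    have hmsum : ∀ k, (∑ i ∈ Finset.range k, m i ≤ v) ∧ (∀ l, k ≤ l →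
        (∑ i ∈ Finset.range k, m i) ⊓ m l = 0) ∧
        N (∑ i ∈ Finset.range k, m i) = ∑ i ∈ Finset.range k, N (m i) := by
      intro k
      induction k with
      | zero => exact ⟨by simpa, fun l _ => by simpa using hm0 l, by simp [hzero]⟩
      | succ k ih =>
        obtain ⟨h1, h2, h3⟩ := ih
        have hs : 0 ≤ ∑ i ∈ Finset.range k, m i := Finset.sum_nonneg fun i _ => hm0 i
        simp only [Finset.sum_range_succ]
        refine ⟨?_, fun l hl => ?_, ?_⟩
        · rw [← inf_add_sup, h2 k le_rfl, zero_add]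
          exact sup_le h1 (inf_le_left.trans (hav k))
        · exact add_inf_eq_zero hs (hm0 k) (hm0 l) (h2 l (by omega)) (hmdis k l (by omega))
        · rw [hadd _ _ hs (hm0 k) (h2 k le_rfl), h3]
    have hasum : ∑ i ∈ Finset.range n, a i = x := by
      rw [ha, Finset.sum_range_sub (fun k => x ⊓ (k • v)), hnv, zero_smul,
        inf_eq_left.2 (le_add_of_nonneg_right hy), inf_eq_right.2 hx, sub_zero]
    have hbsum : ∑ i ∈ Finset.range n, (v - a i) = y := by
      rw [Finset.sum_sub_distrib, hasum, Finset.sum_const, Finset.card_range, hnv,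
        add_sub_cancel_left]
    -- Since `N (x + y) = n • N v`, the defect of `x, y` is at most the sum of the defects of the
    -- pieces.
    have h1 : d ≤ 2 • N (∑ i ∈ Finset.range n, m i) := by
      rw [(hmsum n).2.2, Finset.smul_sum]
      calc d ≤ (∑ i ∈ Finset.range n, N (a i) + ∑ i ∈ Finset.range n, N (v - a i)) - n • N v := by
            rw [hd, ← hsmul n v hv0, hnv]
            refine sub_le_sub_right (add_le_add ?_ ?_) _
            · exact (congrArg N hasum).ge.trans (hsum n _ ha0)
            · exact (congrArg N hbsum).ge.trans (hsum n _ hb0)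
        _ = ∑ i ∈ Finset.range n, (N (a i) + N (v - a i) - N v) := by
            rw [Finset.sum_sub_distrib, Finset.sum_add_distrib, Finset.sum_const, Finset.card_range]
        _ ≤ _ := by
            refine Finset.sum_le_sum fun i _ => ?_
            have := hdefect (a i) (v - a i) (ha0 i) (hb0 i)
            rw [add_sub_cancel] at this
            exact this.trans (nsmul_le_nsmul_right (hinf _ _ (ha0 i) (hb0 i)) 2)
    have hs : 0 ≤ ∑ i ∈ Finset.range n, m i := Finset.sum_nonneg fun i _ => hm0 i
    have h2 : ‖d‖ ≤ ‖2 • N (∑ i ∈ Finset.range n, m i)‖ := by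
      apply norm_le_norm_of_abs_le_abs
      rw [abs_of_nonneg hd0, abs_of_nonneg (hd0.trans h1)]; exact h1
    have h3 : ‖∑ i ∈ Finset.range n, m i‖ ≤ ‖v‖ := by
      apply norm_le_norm_of_abs_le_abs
      rw [abs_of_nonneg hs, abs_of_nonneg hv0]; exact (hmsum n).1
    have h4 : ‖v‖ = (n : ℝ)⁻¹ * ‖x + y‖ := by
      rw [hv, norm_smul, Real.norm_of_nonneg (by positivity)]
    calc ‖d‖ ≤ 2 * ‖N (∑ i ∈ Finset.range n, m i)‖ := h2.trans (by
            rw [two_nsmul, two_mul]; exact norm_add_le _ _)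
      _ ≤ 2 * (|C| * ‖v‖) := by
            have := hbd _ hs
            have h5 := mul_le_mul (le_abs_self C) h3 (norm_nonneg _) (abs_nonneg C)
            linarith
      _ = _ := by rw [h4]; ring
  have hlim : Filter.Tendsto (fun n : ℕ => (2 * |C| * ‖x + y‖) * (n : ℝ)⁻¹) Filter.atTop (nhds 0) := by
    simpa using tendsto_inv_atTop_nhds_zero_nat (𝕜 := ℝ).const_mul (2 * |C| * ‖x + y‖)
  have : ‖d‖ ≤ 0 := ge_of_tendsto hlim (Filter.eventually_atTop.2 ⟨1, fun n hn => key n hn⟩)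
  have hd' : d = 0 := norm_le_zero_iff.1 this
  exact (sub_eq_zero.1 hd').symm

theorem norm_le_norm_of_nonneg_of_le {a b : X} (ha : 0 ≤ a) (hab : a ≤ b) : ‖a‖ ≤ ‖b‖ :=
  norm_le_norm_of_abs_le_abs (by rwa [abs_of_nonneg ha, abs_of_nonneg (ha.trans hab)])

variable [NormedSpace ℝ X] [IsOrderedModule ℝ X]

omit [IsOrderedModule ℝ X] in
theorem nonpos_of_forall_pos_le_smul {a b : X} (h : ∀ ε : ℝ, 0 < ε → a ≤ ε • b) : a ≤ 0 := by
  have hlim : Filter.Tendsto (fun ε : ℝ => ε • b) (nhdsWithin 0 (Set.Ioi 0)) (nhds 0) := by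
    have : Filter.Tendsto (fun ε : ℝ => ε • b) (nhds 0) (nhds ((0 : ℝ) • b)) :=
      (continuous_id.smul continuous_const).tendsto 0
    rw [zero_smul] at this
    exact this.mono_left nhdsWithin_le_nhds
  exact ge_of_tendsto hlim (eventually_nhdsWithin_of_forall fun ε hε => h ε hε)

theorem nonpos_of_forall_nsmul_le {a b : X} (h : ∀ n : ℕ, n • a ≤ b) : a ≤ 0 := by
  refine nonpos_of_forall_pos_le_smul (b := b⁺) fun ε hε => ?_
  obtain ⟨n, hn⟩ := exists_nat_gt ε⁻¹
  have hn0 : 0 < (n : ℝ) := (inv_pos.2 hε).trans hn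
  have h1 : a ≤ (n : ℝ)⁻¹ • b⁺ := by
    have := smul_le_smul_of_nonneg_left ((h n).trans (le_posPart b)) (inv_pos.2 hn0).le
    rwa [← Nat.cast_smul_eq_nsmul ℝ, smul_smul, inv_mul_cancel₀ hn0.ne', one_smul] at this
  exact h1.trans (smul_le_smul_of_nonneg_right (inv_le_of_inv_le₀ hε hn.le) (posPart_nonneg _))

/-! ### Band preserving maps. -/

section BandPreserving

variable {A : X → X} {C : ℝ} (hadd : ∀ x y, 0 ≤ x → 0 ≤ y → A (x + y) = A x + A y)
  (hbd : ∀ x, 0 ≤ x → ‖A x‖ ≤ C * ‖x‖)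
  (hband : ∀ x y, 0 ≤ x → 0 ≤ y → x ⊓ y = 0 → |A x| ⊓ y = 0)

include hadd hbd hband

/-- Applying band preservation twice turns `x ⊓ y = 0` first into `|A x| ⊓ y = 0`, then into `|A x|
⊓ |A y| = 0`. So the map `|A ·|` preserves disjointness. -/
theorem abs_map_add_of_band_preserving {x y : X} (hx : 0 ≤ x) (hy : 0 ≤ y) :
    |A (x + y)| = |A x| + |A y| := by
  refine map_add_of_disjointness_preserving (N := fun x => |A x|) (C := C) ?_ ?_ ?_ ?_ ?_ hx hy
  · intro x y hx hy
    rw [hadd x y hx hy]; exact abs_add_le _ _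
  · intro x y hx hy
    have : A x = A (x + y) - A y := by rw [hadd x y hx hy, add_sub_cancel_right]
    rw [this]; exact abs_sub_le_abs_add_abs _ _
  · intro n x hx
    rw [map_nsmul_of_add hadd n hx, ← Nat.cast_smul_eq_nsmul ℝ, ← Nat.cast_smul_eq_nsmul ℝ,
      abs_smul_of_nonneg n.cast_nonneg]
  · intro x y hx hy h
    have h1 := hband x y hx hy h
    rw [inf_comm] at h1 ⊢
    exact hband y |A x| hy (abs_nonneg _) h1
  · intro x hx
    rw [norm_abs_eq_norm]; exact hbd x hx

theorem posPart_map_add_of_band_preserving {x y : X} (hx : 0 ≤ x) (hy : 0 ≤ y) :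
    (A (x + y))⁺ = (A x)⁺ + (A y)⁺ := by
  have h1 : ∀ a : X, a⁺ = (2⁻¹ : ℝ) • (|a| + a) := fun a => by
    rw [abs_add_eq_two_nsmul_posPart, ← Nat.cast_smul_eq_nsmul ℝ, smul_smul]; simp
  rw [h1, h1, h1, abs_map_add_of_band_preserving hadd hbd hband hx hy, hadd x y hx hy, ← smul_add,
    add_add_add_comm]

theorem negPart_map_le_of_band_preserving {x y : X} (hy : 0 ≤ y) (hyx : y ≤ x) :
    (A y)⁻ ≤ (A x)⁻ := by
  have h1 : ∀ a : X, (2 : ℝ) • a⁻ = |a| - a := fun a => by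
    rw [two_smul, ← two_nsmul, ← abs_sub_eq_two_nsmul_negPart]
  have h2 := abs_map_add_of_band_preserving hadd hbd hband hy (sub_nonneg.2 hyx)
  have h3 := hadd y (x - y) hy (sub_nonneg.2 hyx)
  rw [add_sub_cancel] at h2 h3
  have h4 : (2 : ℝ) • (A y)⁻ ≤ (2 : ℝ) • (A x)⁻ := by
    rw [h1, h1, h2, h3, add_sub_add_comm]
    exact le_add_of_nonneg_right (sub_nonneg.2 (le_abs_self _))
  have := smul_le_smul_of_nonneg_left h4 (by norm_num : (0 : ℝ) ≤ 2⁻¹)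
  rwa [smul_smul, smul_smul, inv_mul_cancel₀ two_ne_zero, one_smul, one_smul] at this

/-- A band preserving operator that is not negative at `x` is positive on a nonzero order
interval below `x`. -/
theorem exists_forall_nonneg_of_not_nonpos {x : X} (hx : 0 ≤ x) (hA : ¬ A x ≤ 0) :
    ∃ y, 0 ≤ y ∧ y ≠ 0 ∧ y ≤ x ∧ ∀ z, 0 ≤ z → z ≤ y → 0 ≤ A z := by
  -- If this witness were zero, `A x` would be disjoint from `(A x)⁺`, forcing `A x ≤ 0`. For `z`
  -- below it, `z` and hence `A z` is disjoint from `(A x)⁻`, while `(A z)⁻ ≤ (A x)⁻`; so `(A z)⁻ =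
  -- 0`.
  refine ⟨x ⊓ (A x)⁺, le_inf hx (posPart_nonneg _), fun h => hA ?_, inf_le_left, ?_⟩
  · have h1 := hband x _ hx (posPart_nonneg _) h
    exact posPart_eq_zero.1 (eq_zero_of_le_of_inf_eq_zero (posPart_nonneg _)
      (sup_le (le_abs_self _) (abs_nonneg _)) le_rfl h1)
  · intro z hz hzy
    have h1 : z ⊓ (A x)⁻ = 0 := inf_eq_zero_of_le hz (negPart_nonneg _)
      (hzy.trans inf_le_right) le_rfl (posPart_inf_negPart_eq_zero _)
    have h2 := hband z _ hz (negPart_nonneg _) h1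
    exact negPart_eq_zero.1 (eq_zero_of_le_of_inf_eq_zero (negPart_nonneg _)
      (sup_le (neg_le_abs _) (abs_nonneg _))
      (negPart_map_le_of_band_preserving hadd hbd hband hz (hzy.trans inf_le_left)) h2)

end BandPreserving

omit [IsOrderedModule ℝ X] in
theorem norm_le_of_abs_le_smul {a x : X} {M : ℝ} (hM : 0 ≤ M) (h : |a| ≤ M • x) :
    ‖a‖ ≤ M * ‖x‖ := by
  have := norm_le_norm_of_nonneg_of_le (abs_nonneg a) h
  rwa [norm_abs_eq_norm, norm_smul, Real.norm_of_nonneg hM] at this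

omit [HasSolidNorm X] in
theorem abs_inf_eq_zero_of_abs_le_smul {A : X → X} {M : ℝ} (hM : 0 ≤ M)
    (hA : ∀ x, 0 ≤ x → |A x| ≤ M • x) (x y : X) (hx : 0 ≤ x) (hy : 0 ≤ y) (hxy : x ⊓ y = 0) :
    |A x| ⊓ y = 0 :=
  inf_eq_zero_of_le (abs_nonneg _) hy (hA x hx) le_rfl (smul_inf_eq_zero hM hx hy hxy)

/-- A positive isometric band preserving operator is the identity. -/
theorem map_eq_self_of_band_preserving {S : X → X}
    (hadd : ∀ x y, 0 ≤ x → 0 ≤ y → S (x + y) = S x + S y) (h0 : ∀ x, 0 ≤ x → 0 ≤ S x)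
    (hnorm : ∀ x, 0 ≤ x → ‖S x‖ = ‖x‖)
    (hband : ∀ x y, 0 ≤ x → 0 ≤ y → x ⊓ y = 0 → S x ⊓ y = 0) {x : X} (hx : 0 ≤ x) :
    S x = x := by
  -- The sign `σ = 1` treats upper bounds with `M > 1`, and `σ = -1` lower bounds with `M < 1`. A
  -- failure gives `y ≠ 0` with `S y ≥ M • y`, respectively `S y ≤ M • y`, contradicting `‖S y‖ =
  -- ‖y‖`.
  have hle : ∀ (σ M : ℝ), σ = 1 ∨ σ = -1 → 0 ≤ M → σ < σ * M → σ • (S x - M • x) ≤ 0 := by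
    intro σ M hσ hM hσM
    by_contra hcon
    have hσ2 : |σ| = 1 := by rcases hσ with rfl | rfl <;> simp
    have hA1 : ∀ x y, 0 ≤ x → 0 ≤ y → σ • (S (x + y) - M • (x + y)) =
        σ • (S x - M • x) + σ • (S y - M • y) := by
      intro x y hx hy
      rw [hadd x y hx hy, ← smul_add, smul_add M, add_sub_add_comm]
    have hA2 : ∀ x, 0 ≤ x → ‖σ • (S x - M • x)‖ ≤ (1 + M) * ‖x‖ := by
      intro x hx
      rw [norm_smul, Real.norm_eq_abs, hσ2, one_mul, add_mul, one_mul]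
      refine (norm_sub_le _ _).trans ?_
      rw [hnorm x hx, norm_smul, Real.norm_of_nonneg hM]
    have hA3 : ∀ x y, 0 ≤ x → 0 ≤ y → x ⊓ y = 0 → |σ • (S x - M • x)| ⊓ y = 0 := by
      intro x y hx hy hxy
      have h1 : (S x + M • x) ⊓ y = 0 := by
        refine add_inf_eq_zero (h0 x hx) (smul_nonneg hM hx) hy (hband x y hx hy hxy) ?_
        exact smul_inf_eq_zero hM hx hy hxy
      refine inf_eq_zero_of_le (abs_nonneg _) hy ?_ le_rfl h1
      have h2 : |σ • (S x - M • x)| = |S x - M • x| := by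
        rcases hσ with rfl | rfl
        · rw [one_smul]
        · rw [neg_one_smul, abs_neg]
      have := abs_sub_le_abs_add_abs (S x) (M • x)
      rwa [abs_of_nonneg (h0 x hx), abs_of_nonneg (smul_nonneg hM hx), ← h2] at this
    obtain ⟨y, hy0, hyne, -, hy⟩ := exists_forall_nonneg_of_not_nonpos hA1 hA2 hA3 hx hcon
    have h1 := hy y hy0 le_rfl
    have hpos : 0 < ‖y‖ := norm_pos_iff.2 hyne
    have h2 : ‖M • y‖ = M * ‖y‖ := by rw [norm_smul, Real.norm_of_nonneg hM]
    rcases hσ with rfl | rfl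
    · rw [one_smul, sub_nonneg] at h1
      have := norm_le_norm_of_nonneg_of_le (smul_nonneg hM hy0) h1
      rw [h2, hnorm y hy0] at this
      nlinarith
    · rw [neg_one_smul, neg_nonneg, sub_nonpos] at h1
      have := norm_le_norm_of_nonneg_of_le (h0 y hy0) h1
      rw [h2, hnorm y hy0] at this
      nlinarith
  refine le_antisymm (sub_nonpos.1 (nonpos_of_forall_pos_le_smul (b := x) fun ε hε => ?_))
    (sub_nonpos.1 (nonpos_of_forall_pos_le_smul (b := x) fun ε hε => ?_))
  · have := hle 1 (1 + ε) (Or.inl rfl) (by positivity) (by linarith)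
    rw [one_smul, add_smul, one_smul, ← sub_sub, sub_nonpos] at this
    exact this
  · have := hle (-1) (max 0 (1 - ε)) (Or.inr rfl) (le_max_left _ _) (by
      rcases max_cases 0 (1 - ε) with h | h <;> rw [h.1] <;> linarith)
    rw [neg_one_smul, neg_nonpos, sub_nonneg] at this
    have h2 : (1 - ε) • x ≤ S x := (smul_le_smul_of_nonneg_right (le_max_right 0 _) hx).trans this
    rw [sub_smul, one_smul] at h2
    rw [sub_le_comm]; exact h2

/-- As `N` vanishes on `a ⊓ n • y`, only `p = (a - n • y)⁺` contributes to `N a`, so `N a ⊓ y ≤ K •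
(p ⊓ y)`. By `inf_posPart_sub_nsmul_le`, `n • (N a ⊓ y) ≤ K • a` for all `n`, and the order is
Archimedean. -/
theorem map_inf_eq_zero_of_map_eq_zero {N : X → X} {K : ℕ}
    (hadd : ∀ x y, 0 ≤ x → 0 ≤ y → N (x + y) = N x + N y) (h0 : ∀ x, 0 ≤ x → 0 ≤ N x)
    (hle : ∀ x, 0 ≤ x → N x ≤ K • x) {y : X} (hy : 0 ≤ y) (hNy : N y = 0) {a : X} (ha : 0 ≤ a) :
    N a ⊓ y = 0 := by
  have hmono : ∀ x z, 0 ≤ x → x ≤ z → N x ≤ N z := fun x z hx hxz => by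
    have := hadd x (z - x) hx (sub_nonneg.2 hxz)
    rw [add_sub_cancel] at this
    rw [this]; exact le_add_of_nonneg_right (h0 _ (sub_nonneg.2 hxz))
  refine le_antisymm ?_ (le_inf (h0 a ha) hy)
  refine nonpos_of_forall_nsmul_le (b := K • a) fun n => ?_
  have hny : 0 ≤ n • y := nsmul_nonneg hy n
  have h1 : N (a ⊓ n • y) = 0 := by
    refine le_antisymm ?_ (h0 _ (le_inf ha hny))
    have := hmono (a ⊓ n • y) (n • y) (le_inf ha hny) inf_le_right
    rwa [map_nsmul_of_add hadd n hy, hNy, smul_zero] at this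
  have h2 : N a = N ((a - n • y)⁺) := by
    rw [← sub_inf_eq_posPart_sub]
    have := hadd (a ⊓ n • y) (a - a ⊓ n • y) (le_inf ha hny) (sub_nonneg.2 inf_le_left)
    rwa [add_sub_cancel, h1, zero_add] at this
  set p := (a - n • y)⁺ with hp
  have hp0 : 0 ≤ p := posPart_nonneg _
  have h3 : ∀ k : ℕ, (k • p) ⊓ y ≤ k • (p ⊓ y) := by
    intro k
    induction k with
    | zero => simp
    | succ k ih =>
      rw [succ_nsmul, succ_nsmul]
      exact (add_inf_le_of_nonneg (nsmul_nonneg hp0 k) hp0 hy).trans (by gcongr)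
  calc n • (N a ⊓ y) ≤ n • (K • (p ⊓ y)) := by
        refine nsmul_le_nsmul_right (le_trans ?_ (h3 K)) n
        rw [h2]; exact inf_le_inf_right _ (hle p hp0)
    _ = K • (n • (y ⊓ p)) := by rw [smul_comm, inf_comm]
    _ ≤ K • a := nsmul_le_nsmul_right (inf_posPart_sub_nsmul_le ha hy n) K

end NormedLattice

/-! ### The real normed lattice of real vectors; real part, imaginary part and modulus. -/

section RealPart

variable {𝕜 : Type*} [RCLike 𝕜] {E : Type*} [NormedAddCommGroup E] [NormedSpace 𝕜 E] {P : Set E}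

theorem im_I_of_ne_zero (hI : (RCLike.I : 𝕜) ≠ 0) : RCLike.im (RCLike.I : 𝕜) = 1 := by
  have h1 : RCLike.im (RCLike.I : 𝕜) ≠ 0 := fun h0 => by
    have := RCLike.norm_sq_eq_def (z := (RCLike.I : 𝕜))
    rw [h0, RCLike.norm_I_of_ne_zero hI] at this
    simp at this
  exact mul_right_cancel₀ h1 (by rw [RCLike.I_im, one_mul])

namespace IsBanachLatticeCone

theorem mem_realVectors (h : IsBanachLatticeCone 𝕜 P) {x : E} (hx : x ∈ P) : x ∈ realVectors P :=
  ⟨x, hx, 0, h.isCone.zero_mem, by simp⟩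

/-- The additive group of real vectors of a Banach lattice. -/
def realPart (h : IsBanachLatticeCone 𝕜 P) : AddSubgroup E where
  carrier := realVectors P
  zero_mem' := h.mem_realVectors h.isCone.zero_mem
  add_mem' := by
    rintro _ _ ⟨a, ha, b, hb, rfl⟩ ⟨c, hc, d, hd, rfl⟩
    exact ⟨a + c, h.isCone.add_mem _ ha _ hc, b + d, h.isCone.add_mem _ hb _ hd, by abel⟩
  neg_mem' := by
    rintro _ ⟨a, ha, b, hb, rfl⟩
    exact ⟨b, hb, a, ha, by abel⟩

variable (h : IsBanachLatticeCone 𝕜 P)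

theorem real_smul_mem (h : IsBanachLatticeCone 𝕜 P) (r : ℝ) {x : E}
    (hx : x ∈ realVectors P) : (r : 𝕜) • x ∈ realVectors P := by
  have key : ∀ s : ℝ, 0 ≤ s → ∀ y ∈ realVectors P, (s : 𝕜) • y ∈ realVectors P := by
    rintro s hs _ ⟨a, ha, b, hb, rfl⟩
    exact ⟨_, h.isCone.smul_mem s hs a ha, _, h.isCone.smul_mem s hs b hb, by rw [smul_sub]⟩
  rcases le_total 0 r with hr | hr
  · exact key r hr x hx
  · have := h.realPart.neg_mem (key (-r) (by linarith) x hx)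
    rwa [RCLike.ofReal_neg, neg_smul, neg_neg] at this

noncomputable instance : Module ℝ h.realPart where
  smul r x := ⟨(r : 𝕜) • (x : E), h.real_smul_mem r x.2⟩
  one_smul x := Subtype.ext (by change ((1 : ℝ) : 𝕜) • (x : E) = x; simp)
  mul_smul r s x := Subtype.ext (by
    change ((r * s : ℝ) : 𝕜) • (x : E) = (r : 𝕜) • (s : 𝕜) • (x : E)
    rw [RCLike.ofReal_mul, mul_smul])
  smul_zero r := Subtype.ext (smul_zero _)
  smul_add r x y := Subtype.ext (smul_add _ _ _)
  add_smul r s x := Subtype.ext (by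
    change ((r + s : ℝ) : 𝕜) • (x : E) = (r : 𝕜) • (x : E) + (s : 𝕜) • (x : E)
    rw [RCLike.ofReal_add, add_smul])
  zero_smul x := Subtype.ext (by change ((0 : ℝ) : 𝕜) • (x : E) = 0; simp)

variable {h}

@[simp]
theorem coe_smul (r : ℝ) (x : h.realPart) : ((r • x : h.realPart) : E) = (r : 𝕜) • (x : E) := rfl

noncomputable instance : NormedSpace ℝ h.realPart where
  norm_smul_le r x := by
    change ‖(r : 𝕜) • (x : E)‖ ≤ ‖r‖ * ‖(x : E)‖
    rw [norm_smul, RCLike.norm_ofReal, Real.norm_eq_abs]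

instance : PartialOrder h.realPart where
  le x y := ConeLE P (x : E) y
  le_refl x := by change (x : E) - x ∈ P; rw [sub_self]; exact h.isCone.zero_mem
  le_trans x y z hxy hyz := by
    change (z : E) - x ∈ P
    rw [← sub_add_sub_cancel]; exact h.isCone.add_mem _ hyz _ hxy
  le_antisymm x y hxy hyx := Subtype.ext (sub_eq_zero.1 (h.isCone.salient _ hyx (by
    rw [neg_sub]; exact hxy)))

theorem le_iff {x y : h.realPart} : x ≤ y ↔ ConeLE P (x : E) y := Iff.rfl

theorem nonneg_iff {x : h.realPart} : 0 ≤ x ↔ (x : E) ∈ P := by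
  rw [le_iff, ConeLE, ZeroMemClass.coe_zero, sub_zero]

theorem mem_realVectors_of_coneLE {x y : E} (hx : x ∈ realVectors P) (hxy : ConeLE P x y)
    (h : IsBanachLatticeCone 𝕜 P) : y ∈ realVectors P := by
  have := h.realPart.add_mem hx (h.mem_realVectors hxy)
  rwa [add_sub_cancel] at this

instance : IsOrderedAddMonoid h.realPart where
  add_le_add_left x y hxy z := by
    change (y : E) + z - (x + z) ∈ P
    rw [add_sub_add_right_eq_sub]; exact hxy

instance : IsOrderedModule ℝ h.realPart :=
  IsOrderedModule.of_smul_nonneg fun r hr x hx => by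
    rw [nonneg_iff] at hx ⊢
    exact h.isCone.smul_mem r hr _ hx

theorem exists_isLUB_pair (x y : h.realPart) : ∃ s : h.realPart, IsLUB {x, y} s := by
  obtain ⟨s, hs1, hs2⟩ := h.exists_sup x x.2 y y.2
  refine ⟨⟨s, mem_realVectors_of_coneLE x.2 (hs1 x (by simp)) h⟩, ?_, ?_⟩
  · rintro z (rfl | rfl)
    · exact hs1 _ (by simp)
    · exact hs1 _ (by simp)
  · intro t ht
    refine hs2 t ?_
    rintro z (rfl | rfl)
    · exact ht (by simp)
    · exact ht (by simp)

noncomputable instance : Lattice h.realPart :=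
  { (inferInstance : PartialOrder h.realPart) with
    sup := fun x y => (exists_isLUB_pair x y).choose
    le_sup_left := fun x y => (exists_isLUB_pair x y).choose_spec.1 (by simp)
    le_sup_right := fun x y => (exists_isLUB_pair x y).choose_spec.1 (by simp)
    sup_le := fun x y z hx hy => (exists_isLUB_pair x y).choose_spec.2 (by
      rintro _ (rfl | rfl) <;> assumption)
    inf := fun x y => -(exists_isLUB_pair (-x) (-y)).choose
    inf_le_left := fun x y => neg_le.1 ((exists_isLUB_pair (-x) (-y)).choose_spec.1 (by simp))
    inf_le_right := fun x y => neg_le.1 ((exists_isLUB_pair (-x) (-y)).choose_spec.1 (by simp))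
    le_inf := fun x y z hx hy => le_neg.1 ((exists_isLUB_pair (-y) (-z)).choose_spec.2 (by
      rintro _ (rfl | rfl)
      · exact neg_le_neg hx
      · exact neg_le_neg hy)) }

variable (h)

/-- For real scalars `I = 0` leaves the imaginary part undetermined; setting it to zero makes the
decomposition unique in both cases. -/
theorem exists_re_im (z : E) : ∃ x y : h.realPart, z = x + (RCLike.I : 𝕜) • (y : E) ∧
    ((RCLike.I : 𝕜) = 0 → y = 0) := by
  obtain ⟨x, hx, y, hy, hz⟩ := h.exists_real_imag z
  by_cases hI : (RCLike.I : 𝕜) = 0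
  · exact ⟨⟨x, hx⟩, 0, by simpa [hI] using hz, fun _ => rfl⟩
  · exact ⟨⟨x, hx⟩, ⟨y, hy⟩, hz, fun h => absurd h hI⟩

/-- The real part of a vector. -/
noncomputable def re (z : E) : h.realPart := (h.exists_re_im z).choose

/-- The imaginary part of a vector (zero if the scalars are real). -/
noncomputable def im (z : E) : h.realPart := (h.exists_re_im z).choose_spec.choose

theorem re_add_im (z : E) : (h.re z : E) + (RCLike.I : 𝕜) • (h.im z : E) = z :=
  (h.exists_re_im z).choose_spec.choose_spec.1.symm

theorem im_eq_zero_of_I_eq_zero (hI : (RCLike.I : 𝕜) = 0) (z : E) : h.im z = 0 :=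
  (h.exists_re_im z).choose_spec.choose_spec.2 hI

theorem re_im_unique {z : E} {x y : h.realPart} (hz : z = x + (RCLike.I : 𝕜) • (y : E))
    (hI : (RCLike.I : 𝕜) = 0 → y = 0) : h.re z = x ∧ h.im z = y := by
  have h0 := h.re_add_im z
  by_cases hI' : (RCLike.I : 𝕜) = 0
  · rw [hI hI', h.im_eq_zero_of_I_eq_zero hI']
    refine ⟨Subtype.ext ?_, rfl⟩
    rw [hI', zero_smul, add_zero] at h0 hz
    rw [h0, hz]
  · have h1 : (RCLike.I : 𝕜) • ((h.im z - y : h.realPart) : E) = ((x - h.re z : h.realPart) : E) := by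
      have : (h.re z : E) + (RCLike.I : 𝕜) • (h.im z : E) = x + (RCLike.I : 𝕜) • (y : E) := by
        rw [h0, hz]
      rw [AddSubgroup.coe_sub, AddSubgroup.coe_sub, smul_sub, sub_eq_sub_iff_add_eq_add, add_comm,
        this]
    have h2 := h.real_inf_imag _ (h.im z - y).2 (by rw [h1]; exact (x - h.re z).2)
    have h3 : ((h.im z - y : h.realPart) : E) = 0 := (smul_eq_zero.1 h2).resolve_left hI'
    rw [h2] at h1
    exact ⟨(sub_eq_zero.1 (Subtype.ext h1.symm)).symm, sub_eq_zero.1 (Subtype.ext h3)⟩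

theorem re_add (z w : E) : h.re (z + w) = h.re z + h.re w :=
  (h.re_im_unique (x := h.re z + h.re w) (y := h.im z + h.im w) (by
    conv_lhs => rw [← h.re_add_im z, ← h.re_add_im w]
    push_cast; rw [smul_add]; abel) (fun hI => by
    simp [h.im_eq_zero_of_I_eq_zero hI])).1

theorem im_add (z w : E) : h.im (z + w) = h.im z + h.im w :=
  (h.re_im_unique (x := h.re z + h.re w) (y := h.im z + h.im w) (by
    conv_lhs => rw [← h.re_add_im z, ← h.re_add_im w]
    push_cast; rw [smul_add]; abel) (fun hI => by
    simp [h.im_eq_zero_of_I_eq_zero hI])).2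

theorem re_im_coe (x : h.realPart) : h.re (x : E) = x ∧ h.im (x : E) = 0 :=
  h.re_im_unique (by simp) (fun _ => rfl)

@[simp]
theorem re_coe (x : h.realPart) : h.re (x : E) = x := (h.re_im_coe x).1

@[simp]
theorem im_coe (x : h.realPart) : h.im (x : E) = 0 := (h.re_im_coe x).2

theorem re_im_smul (c : 𝕜) (z : E) :
    h.re (c • z) = RCLike.re c • h.re z - RCLike.im c • h.im z ∧
      h.im (c • z) = RCLike.re c • h.im z + RCLike.im c • h.re z := by
  refine h.re_im_unique ?_ (fun hI => by
    simp [h.im_eq_zero_of_I_eq_zero hI, RCLike.im_eq_zero hI])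
  conv_lhs => rw [← h.re_add_im z, ← RCLike.re_add_im c]
  push_cast [coe_smul]
  rcases RCLike.I_mul_I (K := 𝕜) with hI | hI
  · simp [hI, RCLike.im_eq_zero hI]
  · simp only [smul_add, add_smul, smul_smul, add_mul]
    rw [show ((RCLike.re c : 𝕜) * RCLike.I) = RCLike.I * RCLike.re c from mul_comm _ _,
      show ((RCLike.im c : 𝕜) * RCLike.I * RCLike.I) = - RCLike.im c by rw [mul_assoc, hI]; simp,
      show ((RCLike.im c : 𝕜) * RCLike.I) = RCLike.I * RCLike.im c from mul_comm _ _]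
    rw [neg_smul]; abel

theorem re_smul (c : 𝕜) (z : E) :
    h.re (c • z) = RCLike.re c • h.re z - RCLike.im c • h.im z := (h.re_im_smul c z).1

theorem im_smul (c : 𝕜) (z : E) :
    h.im (c • z) = RCLike.re c • h.im z + RCLike.im c • h.re z := (h.re_im_smul c z).2

theorem re_neg (z : E) : h.re (-z) = -h.re z := by
  have := h.re_smul (-1) z
  simpa using this

theorem re_sub (z w : E) : h.re (z - w) = h.re z - h.re w := by
  rw [sub_eq_add_neg, h.re_add, h.re_neg, ← sub_eq_add_neg]

theorem im_neg (z : E) : h.im (-z) = -h.im z := by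
  have := h.im_smul (-1) z
  simpa using this

theorem im_sub (z w : E) : h.im (z - w) = h.im z - h.im w := by
  rw [sub_eq_add_neg, h.im_add, h.im_neg, ← sub_eq_add_neg]

theorem mem_rotatedRealParts_iff {z x : E} :
    x ∈ rotatedRealParts 𝕜 P z ↔ ∃ c : 𝕜, ‖c‖ = 1 ∧ (h.re (c • z) : E) = x := by
  constructor
  · rintro ⟨hx, c, hc, y, hy, hz⟩
    refine ⟨c, hc, ?_⟩
    by_cases hI : (RCLike.I : 𝕜) = 0
    · rw [(h.re_im_unique (x := ⟨x, hx⟩) (y := 0) (by simpa [hI] using hz) (fun _ => rfl)).1]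
    · rw [(h.re_im_unique (x := ⟨x, hx⟩) (y := ⟨y, hy⟩) hz (fun hI' => absurd hI' hI)).1]
  · rintro ⟨c, hc, rfl⟩
    exact ⟨(h.re _).2, c, hc, h.im (c • z), (h.im _).2, (h.re_add_im _).symm⟩

theorem exists_mod (z : E) : ∃ m : h.realPart, IsModulus 𝕜 P z m ∧ ‖(m : E)‖ = ‖z‖ := by
  obtain ⟨m, hm, hn⟩ := h.exists_modulus z
  refine ⟨⟨m, mem_realVectors_of_coneLE (h.re z).2 (hm.1 _ ?_) h⟩, hm, hn⟩
  exact h.mem_rotatedRealParts_iff.2 ⟨1, by simp, by simp⟩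

/-- The absolute value of a vector. -/
noncomputable def mod (z : E) : h.realPart := (h.exists_mod z).choose

theorem isModulus_mod (z : E) : IsModulus 𝕜 P z (h.mod z) := (h.exists_mod z).choose_spec.1

theorem norm_mod (z : E) : ‖h.mod z‖ = ‖z‖ := (h.exists_mod z).choose_spec.2

theorem re_smul_le_mod {c : 𝕜} (hc : ‖c‖ = 1) (z : E) : h.re (c • z) ≤ h.mod z :=
  (h.isModulus_mod z).1 _ (h.mem_rotatedRealParts_iff.2 ⟨c, hc, rfl⟩)

theorem mod_le {z : E} {m : h.realPart} (hm : ∀ c : 𝕜, ‖c‖ = 1 → h.re (c • z) ≤ m) :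
    h.mod z ≤ m :=
  (h.isModulus_mod z).2 m (fun x hx => by
    obtain ⟨c, hc, rfl⟩ := h.mem_rotatedRealParts_iff.1 hx
    exact hm c hc)

theorem isModulus_iff {z m : E} : IsModulus 𝕜 P z m ↔ (h.mod z : E) = m := by
  refine ⟨fun hm => ?_, fun hm => hm ▸ h.isModulus_mod z⟩
  have h1 := hm.2 _ (h.isModulus_mod z).1
  have h2 := (h.isModulus_mod z).2 _ hm.1
  exact sub_eq_zero.1 (h.isCone.salient _ h1 (by rw [neg_sub]; exact h2))

theorem re_le_mod (z : E) : h.re z ≤ h.mod z := by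
  simpa using h.re_smul_le_mod (c := (1 : 𝕜)) (by simp) z

theorem abs_re_le_mod (z : E) : |h.re z| ≤ h.mod z :=
  abs_le'.2 ⟨h.re_le_mod z, by
    rw [← h.re_neg]
    simpa using h.re_smul_le_mod (c := (-1 : 𝕜)) (by simp) z⟩

theorem mod_nonneg (z : E) : 0 ≤ h.mod z := (abs_nonneg _).trans (h.abs_re_le_mod z)

theorem mod_smul_of_norm_eq_one {c : 𝕜} (hc : ‖c‖ = 1) (z : E) : h.mod (c • z) = h.mod z := by
  have hc0 : c ≠ 0 := by rintro rfl; simp at hc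
  refine le_antisymm (h.mod_le fun d hd => ?_) (h.mod_le fun d hd => ?_)
  · rw [smul_smul]; exact h.re_smul_le_mod (by simp [hc, hd]) z
  · have := h.re_smul_le_mod (c := d * c⁻¹) (by simp [hc, hd]) (c • z)
    rwa [smul_smul, inv_mul_cancel_right₀ hc0] at this

theorem mod_neg (z : E) : h.mod (-z) = h.mod z := by
  simpa using h.mod_smul_of_norm_eq_one (c := (-1 : 𝕜)) (by simp) z

theorem mod_add_le (z w : E) : h.mod (z + w) ≤ h.mod z + h.mod w :=
  h.mod_le fun c hc => by
    rw [smul_add, h.re_add]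
    exact add_le_add (h.re_smul_le_mod hc z) (h.re_smul_le_mod hc w)

theorem mod_sub_le (z w : E) : h.mod (z - w) ≤ h.mod z + h.mod w := by
  rw [sub_eq_add_neg, ← h.mod_neg w]; exact h.mod_add_le _ _

theorem mod_coe (x : h.realPart) : h.mod (x : E) = |x| := by
  refine le_antisymm (h.mod_le fun c hc => ?_) (by simpa using h.abs_re_le_mod (x : E))
  rw [h.re_smul, h.re_coe, h.im_coe, smul_zero, sub_zero]
  have hc' : |RCLike.re c| ≤ 1 := hc ▸ RCLike.abs_re_le_norm c
  calc RCLike.re c • x ≤ |RCLike.re c • x| := le_abs_self _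
    _ = |RCLike.re c| • |x| := by
        rw [← abs_smul_of_nonneg (abs_nonneg _)]
        rcases abs_choice (RCLike.re c) with h | h <;> rw [h]
        rw [neg_smul, abs_neg]
    _ ≤ |x| := smul_le_of_le_one_left (abs_nonneg _) hc'

theorem mod_coe_of_nonneg {x : h.realPart} (hx : 0 ≤ x) : h.mod (x : E) = x := by
  rw [h.mod_coe, abs_of_nonneg hx]

@[simp]
theorem mod_zero : h.mod (0 : E) = 0 := by
  have := h.mod_coe 0
  simpa using this

theorem mod_eq_zero_iff {z : E} : h.mod z = 0 ↔ z = 0 := by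
  refine ⟨fun hz => ?_, fun hz => hz ▸ h.mod_zero⟩
  rw [← norm_eq_zero, ← h.norm_mod, hz, norm_zero]

theorem mod_real_smul {r : ℝ} (hr : 0 ≤ r) (z : E) : h.mod ((r : 𝕜) • z) = r • h.mod z := by
  have key : ∀ (s : ℝ) (w : E), 0 ≤ s → h.mod ((s : 𝕜) • w) ≤ s • h.mod w := fun s w hs =>
    h.mod_le fun c hc => by
      rw [smul_comm, h.re_smul, RCLike.ofReal_re, RCLike.ofReal_im, zero_smul, sub_zero]
      exact smul_le_smul_of_nonneg_left (h.re_smul_le_mod hc w) hs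
  rcases hr.eq_or_lt with rfl | hr
  · simp
  refine le_antisymm (key r z hr.le) ?_
  have := smul_le_smul_of_nonneg_left (key r⁻¹ ((r : 𝕜) • z) (by positivity)) hr.le
  rwa [smul_smul, smul_smul, ← RCLike.ofReal_mul, inv_mul_cancel₀ hr.ne', mul_inv_cancel₀ hr.ne',
    RCLike.ofReal_one, one_smul, one_smul] at this

theorem mod_nsmul (n : ℕ) (z : E) : h.mod (n • z) = n • h.mod z := by
  have := h.mod_real_smul n.cast_nonneg z
  rwa [RCLike.ofReal_natCast, Nat.cast_smul_eq_nsmul, Nat.cast_smul_eq_nsmul] at this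

theorem abs_im_le_mod (z : E) : |h.im z| ≤ h.mod z := by
  by_cases hI : (RCLike.I : 𝕜) = 0
  · rw [h.im_eq_zero_of_I_eq_zero hI, abs_zero]; exact h.mod_nonneg z
  · have h1 : ‖(RCLike.I : 𝕜)‖ = 1 := RCLike.norm_I_of_ne_zero hI
    have h2 := im_I_of_ne_zero hI
    have h3 := h.abs_re_le_mod ((RCLike.I : 𝕜) • z)
    rwa [h.re_smul, RCLike.I_re, h2, zero_smul, one_smul, zero_sub, abs_neg,
      h.mod_smul_of_norm_eq_one h1] at h3

theorem mod_I_smul_le (x : h.realPart) : h.mod ((RCLike.I : 𝕜) • (x : E)) ≤ |x| := by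
  by_cases hI : (RCLike.I : 𝕜) = 0
  · rw [hI, zero_smul, h.mod_zero]; exact abs_nonneg _
  · rw [h.mod_smul_of_norm_eq_one (RCLike.norm_I_of_ne_zero hI), h.mod_coe]

theorem mod_le_abs_re_add_abs_im (z : E) : h.mod z ≤ |h.re z| + |h.im z| := by
  conv_lhs => rw [← h.re_add_im z]
  refine (h.mod_add_le _ _).trans (add_le_add (h.mod_coe _).le (h.mod_I_smul_le _))

variable {h}

instance : HasSolidNorm h.realPart where
  solid x y hxy := by
    rw [← h.mod_coe, ← h.mod_coe] at hxy
    change ‖(x : E)‖ ≤ ‖(y : E)‖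
    rw [← h.norm_mod, ← h.norm_mod (y : E)]
    exact h.norm_mono _ (nonneg_iff.1 (h.mod_nonneg _)) _ (nonneg_iff.1 (h.mod_nonneg _)) hxy

theorem norm_le_of_mod_le {z : E} {m : h.realPart} (hz : h.mod z ≤ m) : ‖z‖ ≤ ‖m‖ := by
  rw [← h.norm_mod]; exact norm_le_norm_of_nonneg_of_le (h.mod_nonneg z) hz

theorem norm_re_le (z : E) : ‖h.re z‖ ≤ ‖z‖ := by
  rw [← h.norm_mod z, ← norm_abs_eq_norm]
  exact norm_le_norm_of_nonneg_of_le (abs_nonneg _) (h.abs_re_le_mod z)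

theorem norm_im_le (z : E) : ‖h.im z‖ ≤ ‖z‖ := by
  rw [← h.norm_mod z, ← norm_abs_eq_norm]
  exact norm_le_norm_of_nonneg_of_le (abs_nonneg _) (h.abs_im_le_mod z)

theorem norm_coe (x : h.realPart) : ‖(x : E)‖ = ‖x‖ := rfl

theorem lipschitzWith_mod : LipschitzWith 1 h.mod :=
  LipschitzWith.of_dist_le_mul fun z w => by
    rw [NNReal.coe_one, one_mul, dist_eq_norm, dist_eq_norm, ← h.norm_mod (z - w)]
    refine norm_le_norm_of_abs_le_abs ?_
    rw [abs_of_nonneg (h.mod_nonneg _)]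
    refine abs_le'.2 ⟨?_, ?_⟩
    · rw [sub_le_iff_le_add]; simpa using h.mod_add_le (z - w) w
    · rw [neg_sub, sub_le_iff_le_add, ← h.mod_neg (z - w), neg_sub]
      simpa using h.mod_add_le (w - z) z

/-- The modulus of an additive, bounded, disjointness preserving map is additive on the positive
cone. -/
theorem mod_map_add {X : Type*} [NormedAddCommGroup X] [Lattice X] [HasSolidNorm X]
    [IsOrderedAddMonoid X] [NormedSpace ℝ X] [IsOrderedModule ℝ X] {A : X → E} {C : ℝ}
    (hadd : ∀ x y, 0 ≤ x → 0 ≤ y → A (x + y) = A x + A y)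
    (hbd : ∀ x, 0 ≤ x → ‖A x‖ ≤ C * ‖x‖)
    (hdis : ∀ x y, 0 ≤ x → 0 ≤ y → x ⊓ y = 0 → h.mod (A x) ⊓ h.mod (A y) = 0)
    {x y : X} (hx : 0 ≤ x) (hy : 0 ≤ y) :
    h.mod (A (x + y)) = h.mod (A x) + h.mod (A y) := by
  refine map_add_of_disjointness_preserving (N := fun x => h.mod (A x)) (C := C) ?_ ?_ ?_ hdis ?_
    hx hy
  · intro x y hx hy
    rw [hadd x y hx hy]; exact h.mod_add_le _ _
  · intro x y hx hy
    have : A x = A (x + y) - A y := by rw [hadd x y hx hy, add_sub_cancel_right]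
    rw [this]; exact h.mod_sub_le _ _
  · intro n x hx
    rw [map_nsmul_of_add hadd n hx, h.mod_nsmul]
  · intro x hx
    rw [h.norm_mod]; exact hbd x hx

end IsBanachLatticeCone

end RealPart

/-! ### The center and its absolute value. -/

section Center

variable {𝕜 : Type*} [RCLike 𝕜] {E : Type*} [NormedAddCommGroup E] [NormedSpace 𝕜 E] {P : Set E}

namespace IsBanachLatticeCone

variable (h : IsBanachLatticeCone 𝕜 P)

theorem map_eq_posPart_negPart {F : Type*} [AddCommGroup F] [Module 𝕜 F] (T : E →ₗ[𝕜] F) (z : E) :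
    T z = T ((h.re z)⁺ : h.realPart) - T ((h.re z)⁻ : h.realPart) +
      (RCLike.I : 𝕜) • (T ((h.im z)⁺ : h.realPart) - T ((h.im z)⁻ : h.realPart)) := by
  rw [← map_sub, ← map_sub, ← map_smul, ← map_add, ← AddSubgroup.coe_sub, ← AddSubgroup.coe_sub,
    posPart_sub_negPart, posPart_sub_negPart, h.re_add_im]

theorem clm_ext {S T : E →L[𝕜] E} (hST : ∀ x : h.realPart, 0 ≤ x → S (x : E) = T (x : E)) :
    S = T := by
  ext z
  have h1 := h.map_eq_posPart_negPart (S : E →ₗ[𝕜] E) z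
  have h2 := h.map_eq_posPart_negPart (T : E →ₗ[𝕜] E) z
  simp only [ContinuousLinearMap.coe_coe] at h1 h2
  rw [h1, h2, hST _ (posPart_nonneg _), hST _ (posPart_nonneg _), hST _ (negPart_nonneg _),
    hST _ (negPart_nonneg _)]

/-- An additive and bounded map on the positive cone extends to a bounded operator. -/
theorem exists_clm {f : h.realPart → E} {C : ℝ}
    (hadd : ∀ x y, 0 ≤ x → 0 ≤ y → f (x + y) = f x + f y)
    (hbd : ∀ x, 0 ≤ x → ‖f x‖ ≤ C * ‖x‖) :
    ∃ T : E →L[𝕜] E, ∀ x : h.realPart, 0 ≤ x → T (x : E) = f x := by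
  have hf0 : f 0 = 0 := by simpa using hadd 0 0 le_rfl le_rfl
  let F : h.realPart →+ E := AddMonoidHom.mk' (fun x => f x⁺ - f x⁻) (by
    intro x y
    have h1 : (x + y)⁺ + (x⁻ + y⁻) = (x⁺ + y⁺) + (x + y)⁻ := by
      have h2 := posPart_sub_negPart x
      have h3 := posPart_sub_negPart y
      have h4 := posPart_sub_negPart (x + y)
      rw [sub_eq_iff_eq_add] at h2 h3 h4
      rw [h4, h2, h3]
      abel
    have h5 := congrArg f h1
    have hp : ∀ z : h.realPart, 0 ≤ z⁺ := posPart_nonneg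
    have hn : ∀ z : h.realPart, 0 ≤ z⁻ := negPart_nonneg
    rw [hadd _ _ (hp _) (add_nonneg (hn _) (hn _)), hadd _ _ (hn _) (hn _),
      hadd _ _ (add_nonneg (hp _) (hp _)) (hn _), hadd _ _ (hp _) (hp _)] at h5
    change f (x + y)⁺ - f (x + y)⁻ = f x⁺ - f x⁻ + (f y⁺ - f y⁻)
    rw [sub_add_sub_comm, sub_eq_sub_iff_add_eq_add, h5])
  have hF : ∀ x, F x = f x⁺ - f x⁻ := fun _ => rfl
  have hFpos : ∀ x, 0 ≤ x → F x = f x := fun x hx => by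
    rw [hF, posPart_eq_self.2 hx, negPart_eq_zero.2 hx, hf0, sub_zero]
  have hFbd : ∀ x, ‖F x‖ ≤ (2 * |C|) * ‖x‖ := by
    intro x
    have key : ∀ y : h.realPart, 0 ≤ y → y ≤ |x| → ‖f y‖ ≤ |C| * ‖x‖ := fun y hy hyx => by
      refine (hbd y hy).trans (mul_le_mul (le_abs_self C) ?_ (norm_nonneg _) (abs_nonneg C))
      rw [← norm_abs_eq_norm x]
      exact norm_le_norm_of_nonneg_of_le hy hyx
    have h1 := key x⁺ (posPart_nonneg x) (sup_le (le_abs_self x) (abs_nonneg x))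
    have h2 := key x⁻ (negPart_nonneg x) (sup_le (neg_le_abs x) (abs_nonneg x))
    rw [hF]
    refine (norm_sub_le _ _).trans ?_
    linarith
  have hFcont : Continuous F := AddMonoidHomClass.continuous_of_bound F _ hFbd
  -- A continuous additive map is real-linear.
  have hFsmul : ∀ (r : ℝ) x, F (r • x) = (r : 𝕜) • F x := by
    let _ : NormedSpace ℝ E := NormedSpace.restrictScalars ℝ 𝕜 E
    intro r x
    have := map_real_smul F hFcont r x
    rw [this]
    change (algebraMap ℝ 𝕜 r) • F x = _
    rfl
  let T : E →ₗ[𝕜] E :=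
    { toFun := fun z => F (h.re z) + (RCLike.I : 𝕜) • F (h.im z)
      map_add' := fun z w => by
        rw [h.re_add, h.im_add, map_add, map_add, smul_add]; abel
      map_smul' := fun c z => by
        rw [h.re_smul, h.im_smul, map_sub, map_add, hFsmul, hFsmul, hFsmul, hFsmul,
          RingHom.id_apply]
        conv_rhs => rw [← RCLike.re_add_im c]
        rcases RCLike.I_mul_I (K := 𝕜) with hI | hI
        · simp [hI, RCLike.im_eq_zero hI]
        · simp only [smul_add, add_smul, smul_smul, add_mul]
          rw [show ((RCLike.im c : 𝕜) * RCLike.I * RCLike.I) = - RCLike.im c by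
              rw [mul_assoc, hI]; simp,
            mul_comm (RCLike.I : 𝕜), mul_comm (RCLike.I : 𝕜)]
          rw [neg_smul]; abel }
  refine ⟨T.mkContinuous (4 * |C|) fun z => ?_, fun x hx => ?_⟩
  · change ‖F (h.re z) + (RCLike.I : 𝕜) • F (h.im z)‖ ≤ _
    have h1 := hFbd (h.re z)
    have h2 := hFbd (h.im z)
    have h3 : ‖(RCLike.I : 𝕜)‖ ≤ 1 := by
      rw [RCLike.norm_I]; split_ifs <;> norm_num
    have h4 := norm_re_le (h := h) z
    have h5 := norm_im_le (h := h) z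
    have hC := abs_nonneg C
    have h6 := mul_le_mul_of_nonneg_left h4 hC
    have h7 := mul_le_mul_of_nonneg_left h5 hC
    have h8 := mul_le_mul_of_nonneg_right h3 (norm_nonneg (F (h.im z)))
    refine (norm_add_le _ _).trans ?_
    rw [norm_smul]
    linarith
  · change F (h.re x) + (RCLike.I : 𝕜) • F (h.im x) = _
    rw [h.re_coe, h.im_coe, map_zero, smul_zero, add_zero, hFpos x hx]

theorem mem_idealCenter_iff {T : E →L[𝕜] E} :
    T ∈ idealCenter 𝕜 P ↔ ∃ M : ℝ, 0 < M ∧ ∀ x : h.realPart, 0 ≤ x → h.mod (T x) ≤ M • x := by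
  refine exists_congr fun M => and_congr_right fun hM => ⟨fun hT x hx => ?_, fun hT x hx => ?_⟩
  · obtain ⟨m, hm, hle⟩ := hT x (nonneg_iff.1 hx)
    rw [← h.isModulus_iff.1 hm] at hle
    exact hle
  · exact ⟨_, h.isModulus_mod _, hT ⟨x, h.mem_realVectors hx⟩ (nonneg_iff.2 hx)⟩

theorem mem_idealCenter_add (h : IsBanachLatticeCone 𝕜 P) {S T : E →L[𝕜] E}
    (hS : S ∈ idealCenter 𝕜 P) (hT : T ∈ idealCenter 𝕜 P) : S + T ∈ idealCenter 𝕜 P := by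
  rw [h.mem_idealCenter_iff] at *
  obtain ⟨M, hM, hS⟩ := hS
  obtain ⟨K, hK, hT⟩ := hT
  refine ⟨M + K, by positivity, fun x hx => ?_⟩
  rw [add_smul]
  exact (h.mod_add_le _ _).trans (add_le_add (hS x hx) (hT x hx))

theorem mem_idealCenter_smul (h : IsBanachLatticeCone 𝕜 P) {T : E →L[𝕜] E} {c : 𝕜}
    (hc : ‖c‖ = 1) (hT : T ∈ idealCenter 𝕜 P) : c • T ∈ idealCenter 𝕜 P := by
  rw [h.mem_idealCenter_iff] at *
  obtain ⟨M, hM, hT⟩ := hT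
  refine ⟨M, hM, fun x hx => ?_⟩
  rw [_root_.smul_apply, h.mod_smul_of_norm_eq_one hc]
  exact hT x hx

theorem mem_idealCenter_sub (h : IsBanachLatticeCone 𝕜 P) {S T : E →L[𝕜] E}
    (hS : S ∈ idealCenter 𝕜 P) (hT : T ∈ idealCenter 𝕜 P) : S - T ∈ idealCenter 𝕜 P := by
  have := h.mem_idealCenter_add hS (h.mem_idealCenter_smul (c := (-1 : 𝕜)) (by simp) hT)
  rwa [neg_one_smul, ← sub_eq_add_neg] at this

theorem one_mem_idealCenter (h : IsBanachLatticeCone 𝕜 P) : (1 : E →L[𝕜] E) ∈ idealCenter 𝕜 P :=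
  h.mem_idealCenter_iff.2 ⟨1, one_pos, fun x hx => by
    rw [one_apply_eq_self, h.mod_coe_of_nonneg hx, one_smul]⟩

theorem mem_centerCone_iff {S : E →L[𝕜] E} : S ∈ centerCone 𝕜 P ↔
    S ∈ idealCenter 𝕜 P ∧ ∀ x : h.realPart, 0 ≤ x → S x ∈ P :=
  and_congr_right fun _ => ⟨fun hS x hx => hS x (nonneg_iff.1 hx),
    fun hS x hx => hS ⟨x, h.mem_realVectors hx⟩ (nonneg_iff.2 hx)⟩

variable {h}

theorem disjoint_of_mod_le {A : h.realPart → E} {M : ℝ} (hM : 0 ≤ M)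
    (hA : ∀ x, 0 ≤ x → h.mod (A x) ≤ M • x) {x y : h.realPart} (hx : 0 ≤ x) (hy : 0 ≤ y)
    (hxy : x ⊓ y = 0) : h.mod (A x) ⊓ y = 0 :=
  inf_eq_zero_of_le (h.mod_nonneg _) hy (hA x hx) le_rfl (smul_inf_eq_zero hM hx hy hxy)

theorem disjoint_of_mod_le_of_mod_le {A : h.realPart → E} {M : ℝ} (hM : 0 ≤ M)
    (hA : ∀ x, 0 ≤ x → h.mod (A x) ≤ M • x) {x y : h.realPart} (hx : 0 ≤ x) (hy : 0 ≤ y)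
    (hxy : x ⊓ y = 0) : h.mod (A x) ⊓ h.mod (A y) = 0 := by
  have h1 := disjoint_of_mod_le hM hA hx hy hxy
  rw [inf_comm] at h1 ⊢
  exact disjoint_of_mod_le hM hA hy (h.mod_nonneg _) h1

theorem norm_le_of_mod_le_smul {z : E} {M : ℝ} (hM : 0 ≤ M) {x : h.realPart}
    (hz : h.mod z ≤ M • x) : ‖z‖ ≤ M * ‖x‖ := by
  have := norm_le_of_mod_le hz
  rwa [norm_smul, Real.norm_of_nonneg hM] at this

theorem mod_map_add_of_mod_le {A : h.realPart → E} {M : ℝ} (hM : 0 ≤ M)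
    (hadd : ∀ x y, 0 ≤ x → 0 ≤ y → A (x + y) = A x + A y)
    (hA : ∀ x, 0 ≤ x → h.mod (A x) ≤ M • x) {x y : h.realPart} (hx : 0 ≤ x) (hy : 0 ≤ y) :
    h.mod (A (x + y)) = h.mod (A x) + h.mod (A y) :=
  mod_map_add hadd (fun x hx => norm_le_of_mod_le_smul hM (hA x hx))
    (fun _ _ hx hy hxy => disjoint_of_mod_le_of_mod_le hM hA hx hy hxy) hx hy

variable (h)

/-- An operator in the center that maps positive vectors to real vectors is a difference of
positive operators in the center. -/
theorem mem_realVectors_centerCone {V : E →L[𝕜] E} (hV : V ∈ idealCenter 𝕜 P)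
    (hreal : ∀ x : h.realPart, 0 ≤ x → V x ∈ realVectors P) :
    V ∈ realVectors (centerCone 𝕜 P) := by
  obtain ⟨M, hM, hVM⟩ := h.mem_idealCenter_iff.1 hV
  let A : h.realPart → h.realPart := fun x => h.re (V x)
  have hVA : ∀ x : h.realPart, 0 ≤ x → V x = A x := fun x hx => by
    have := h.re_coe ⟨V x, hreal x hx⟩
    exact congrArg Subtype.val this.symm
  have hadd : ∀ x y : h.realPart, 0 ≤ x → 0 ≤ y → A (x + y) = A x + A y := fun x y _ _ => by
    simp only [A, AddSubgroup.coe_add, map_add, h.re_add]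
  have hle : ∀ x, 0 ≤ x → |A x| ≤ M • x := fun x hx => (h.abs_re_le_mod _).trans (hVM x hx)
  have hbd : ∀ x, 0 ≤ x → ‖A x‖ ≤ M * ‖x‖ := fun x hx => norm_le_of_abs_le_smul hM.le (hle x hx)
  have hband := abs_inf_eq_zero_of_abs_le_smul hM.le hle
  have hpos : ∀ x, 0 ≤ x → h.mod (((A x)⁺ : h.realPart) : E) ≤ M • x := fun x hx => by
    rw [h.mod_coe_of_nonneg (posPart_nonneg _)]
    exact (sup_le (le_abs_self _) (abs_nonneg _)).trans (hle x hx)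
  -- `V` is band preserving, so its pointwise positive part is additive on the cone and extends to
  -- an operator `S` above both `0` and `V`.
  obtain ⟨S, hS⟩ := h.exists_clm (f := fun x => (((A x)⁺ : h.realPart) : E)) (C := M)
    (fun x y hx hy => by
      rw [posPart_map_add_of_band_preserving hadd hbd hband hx hy, AddSubgroup.coe_add])
    (fun x hx => norm_le_of_mod_le_smul hM.le (hpos x hx))
  have hSc : S ∈ idealCenter 𝕜 P := h.mem_idealCenter_iff.2 ⟨M, hM, fun x hx => by
    rw [hS x hx]; exact hpos x hx⟩
  refine ⟨S, h.mem_centerCone_iff.2 ⟨hSc, fun x hx => ?_⟩, S - V, h.mem_centerCone_iff.2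
    ⟨h.mem_idealCenter_sub hSc hV, fun x hx => ?_⟩, by abel⟩
  · rw [hS x hx]; exact nonneg_iff.1 (posPart_nonneg _)
  · rw [_root_.sub_apply, hS x hx, hVA x hx]
    exact le_posPart (A x)

/-- Together with `exists_eq_re_of_mem_rotatedRealParts` this identifies the rotated real parts of
`T` in the center with the pointwise ones, linking the operator order to the order of the space. -/
theorem exists_mem_rotatedRealParts_centerCone {T : E →L[𝕜] E} (hT : T ∈ idealCenter 𝕜 P) {c : 𝕜}
    (hc : ‖c‖ = 1) : ∃ X ∈ rotatedRealParts 𝕜 (centerCone 𝕜 P) T, X ∈ idealCenter 𝕜 P ∧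
      ∀ x : h.realPart, 0 ≤ x → X x = h.re (c • T x) := by
  obtain ⟨M, hM, hTM⟩ := h.mem_idealCenter_iff.1 (h.mem_idealCenter_smul hc hT)
  have key : ∀ ρ : E → h.realPart, (∀ z w, ρ (z + w) = ρ z + ρ w) → (∀ z, |ρ z| ≤ h.mod z) →
      ∃ X ∈ realVectors (centerCone 𝕜 P), X ∈ idealCenter 𝕜 P ∧
        ∀ x : h.realPart, 0 ≤ x → X x = ρ (c • T x) := by
    intro ρ hρ hρm
    have hle : ∀ x : h.realPart, 0 ≤ x → h.mod (ρ (c • T x) : E) ≤ M • x := fun x hx => by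
      rw [h.mod_coe]; exact (hρm _).trans (hTM x hx)
    have hadd : ∀ x y : h.realPart, 0 ≤ x → 0 ≤ y → (ρ (c • T (x + y : h.realPart)) : E) =
        ρ (c • T x) + ρ (c • T y) := fun x y _ _ => by
      rw [AddSubgroup.coe_add _ x y, map_add, smul_add, hρ, AddSubgroup.coe_add]
    obtain ⟨X, hX⟩ := h.exists_clm (f := fun x => (ρ (c • T x) : E)) (C := M) hadd
      (fun x hx => norm_le_of_mod_le_smul hM.le (hle x hx))
    have hXc : X ∈ idealCenter 𝕜 P := h.mem_idealCenter_iff.2 ⟨M, hM, fun x hx => by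
      rw [hX x hx]; exact hle x hx⟩
    exact ⟨X, h.mem_realVectors_centerCone hXc (fun x hx => by rw [hX x hx]; exact (ρ _).2), hXc, hX⟩
  obtain ⟨X, hX1, hX2, hX3⟩ := key h.re h.re_add h.abs_re_le_mod
  obtain ⟨Y, hY1, hY2, hY3⟩ := key h.im h.im_add h.abs_im_le_mod
  refine ⟨X, ⟨hX1, c, hc, Y, hY1, h.clm_ext fun x hx => ?_⟩, hX2, hX3⟩
  rw [_root_.add_apply, _root_.smul_apply, _root_.smul_apply,
    hX3 x hx, hY3 x hx, h.re_add_im]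

theorem exists_eq_re_of_mem_rotatedRealParts {T X : E →L[𝕜] E}
    (hX : X ∈ rotatedRealParts 𝕜 (centerCone 𝕜 P) T) : X ∈ idealCenter 𝕜 P ∧
      ∃ c : 𝕜, ‖c‖ = 1 ∧ ∀ x : h.realPart, 0 ≤ x → X x = h.re (c • T x) := by
  have key : ∀ V ∈ realVectors (centerCone 𝕜 P), V ∈ idealCenter 𝕜 P ∧
      ∀ x : h.realPart, 0 ≤ x → V x ∈ realVectors P := by
    rintro _ ⟨A, hA, B, hB, rfl⟩
    rw [h.mem_centerCone_iff] at hA hB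
    exact ⟨h.mem_idealCenter_sub hA.1 hB.1, fun x hx => ⟨A x, hA.2 x hx, B x, hB.2 x hx, rfl⟩⟩
  obtain ⟨hX, c, hc, Y, hY, hcT⟩ := hX
  obtain ⟨hX1, hX2⟩ := key X hX
  obtain ⟨-, hY2⟩ := key Y hY
  refine ⟨hX1, c, hc, fun x hx => ?_⟩
  have hx' : c • T x = X x + (RCLike.I : 𝕜) • Y x := DFunLike.congr_fun hcT (x : E)
  by_cases hI : (RCLike.I : 𝕜) = 0
  · rw [(h.re_im_unique (x := ⟨X x, hX2 x hx⟩) (y := 0) (by simpa [hI] using hx')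
      (fun _ => rfl)).1]
  · rw [(h.re_im_unique (x := ⟨X x, hX2 x hx⟩) (y := ⟨Y x, hY2 x hx⟩) hx'
      (fun hI' => absurd hI' hI)).1]

/-- The absolute value of `T` in the center is `1` iff `|T x| = x` for all `x ≥ 0`. -/
theorem isModulus_one_iff {T : E →L[𝕜] E} (hT : T ∈ idealCenter 𝕜 P) :
    IsModulus 𝕜 (centerCone 𝕜 P) T 1 ↔ ∀ x : h.realPart, 0 ≤ x → h.mod (T x) = x := by
  constructor
  · rintro ⟨hub, hleast⟩ x hx
    obtain ⟨M, hM, hTM⟩ := h.mem_idealCenter_iff.1 hT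
    refine le_antisymm (h.mod_le fun c hc => ?_) ?_
    · obtain ⟨X, hX, -, hXx⟩ := h.exists_mem_rotatedRealParts_centerCone hT hc
      have := (h.mem_centerCone_iff.1 (hub X hX)).2 x hx
      rw [_root_.sub_apply, hXx x hx] at this
      exact this
    · have hadd : ∀ x y : h.realPart, 0 ≤ x → 0 ≤ y →
          h.mod (T ((x + y : h.realPart) : E)) = h.mod (T x) + h.mod (T y) := fun x y hx hy =>
        mod_map_add_of_mod_le (A := fun x => T x) hM.le (fun x y _ _ => by
          rw [AddSubgroup.coe_add, map_add]) hTM hx hy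
      -- The pointwise modulus `S` of `T` is an upper bound of the rotated real parts, so the least
      -- one, `1`, lies below it.
      obtain ⟨S, hS⟩ := h.exists_clm (f := fun x => (h.mod (T x) : E)) (C := M)
        (fun x y hx hy => by rw [hadd x y hx hy, AddSubgroup.coe_add])
        (fun x hx => by
          rw [norm_coe, h.norm_mod]; exact norm_le_of_mod_le_smul hM.le (hTM x hx))
      have hSc : S ∈ idealCenter 𝕜 P := h.mem_idealCenter_iff.2 ⟨M, hM, fun x hx => by
        rw [hS x hx, h.mod_coe_of_nonneg (h.mod_nonneg _)]; exact hTM x hx⟩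
      have h1 := hleast S fun X hX => by
        obtain ⟨hXc, c, hc, hXx⟩ := h.exists_eq_re_of_mem_rotatedRealParts hX
        refine h.mem_centerCone_iff.2 ⟨h.mem_idealCenter_sub hSc hXc, fun x hx => ?_⟩
        rw [_root_.sub_apply, hS x hx, hXx x hx]
        exact h.re_smul_le_mod hc _
      have h2 := (h.mem_centerCone_iff.1 h1).2 x hx
      rw [_root_.sub_apply, hS x hx] at h2
      exact h2
  · intro hmod
    refine ⟨fun X hX => ?_, fun t ht => ?_⟩
    · obtain ⟨hXc, c, hc, hXx⟩ := h.exists_eq_re_of_mem_rotatedRealParts hX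
      refine h.mem_centerCone_iff.2 ⟨h.mem_idealCenter_sub h.one_mem_idealCenter hXc,
        fun x hx => ?_⟩
      rw [_root_.sub_apply, hXx x hx]
      have := h.re_smul_le_mod hc (T x)
      rw [hmod x hx] at this
      exact this
    · obtain ⟨X, hX, hXc, hXx⟩ := h.exists_mem_rotatedRealParts_centerCone hT (c := 1) (by simp)
      have h1 := h.mem_centerCone_iff.1 (ht X hX)
      -- A priori an upper bound is just some operator; it lies in the center because `t - X` and
      -- `X` do.
      have htc : t ∈ idealCenter 𝕜 P := by
        have := h.mem_idealCenter_add h1.1 hXc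
        rwa [sub_add_cancel] at this
      refine h.mem_centerCone_iff.2 ⟨h.mem_idealCenter_sub htc h.one_mem_idealCenter,
        fun x hx => ?_⟩
      have htx : t x ∈ realVectors P := by
        refine mem_realVectors_of_coneLE (x := X x) ?_ (h1.2 x hx) h
        rw [hXx x hx]; exact (h.re _).2
      have h2 : h.mod (T x) ≤ ⟨t x, htx⟩ := h.mod_le fun c hc => by
        obtain ⟨Y, hY, -, hYx⟩ := h.exists_mem_rotatedRealParts_centerCone hT hc
        have := (h.mem_centerCone_iff.1 (ht Y hY)).2 x hx
        rw [_root_.sub_apply, hYx x hx] at this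
        exact this
      rw [hmod x hx] at h2
      exact h2

end IsBanachLatticeCone

end Center

/-! ### Cones with the same closed ideals: direction (a). -/

section SameIdeals

variable {𝕜 : Type*} [RCLike 𝕜] {E : Type*} [NormedAddCommGroup E] [NormedSpace 𝕜 E] {P W : Set E}

namespace IsBanachLatticeCone

variable (h : IsBanachLatticeCone 𝕜 P) (hW : IsBanachLatticeCone 𝕜 W)

theorem mod_smul (c : 𝕜) (z : E) : h.mod (c • z) = ‖c‖ • h.mod z := by
  rcases eq_or_ne c 0 with rfl | hc
  · simp
  · have hc' : (‖c‖ : 𝕜) ≠ 0 := by simpa using hc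
    have h1 : ‖c * (‖c‖ : 𝕜)⁻¹‖ = 1 := by
      rw [norm_mul, norm_inv, RCLike.norm_ofReal, abs_norm, mul_inv_cancel₀ (norm_ne_zero_iff.2 hc)]
    rw [← h.mod_real_smul (norm_nonneg c), ← h.mod_smul_of_norm_eq_one h1 ((‖c‖ : 𝕜) • z), smul_smul,
      inv_mul_cancel_right₀ hc']

theorem mem_of_mod_le {J : Submodule 𝕜 E} (hJ : IsClosedIdeal 𝕜 P J) {x y : E} (hx : x ∈ J)
    (hyx : h.mod y ≤ h.mod x) : y ∈ J :=
  hJ.2 x hx y _ _ (h.isModulus_mod x) (h.isModulus_mod y) hyx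

theorem isClosedIdeal_of_mod_le {J : Submodule 𝕜 E} (hcl : IsClosed (J : Set E))
    (hJ : ∀ x ∈ J, ∀ y, h.mod y ≤ h.mod x → y ∈ J) : IsClosedIdeal 𝕜 P J := by
  refine ⟨hcl, fun x hx y mx my hmx hmy hle => hJ x hx y ?_⟩
  rw [← h.isModulus_iff.1 hmx, ← h.isModulus_iff.1 hmy] at hle
  exact hle

/-- The disjoint complement of a set. -/
noncomputable def disjointCompl (A : Set E) : Submodule 𝕜 E where
  carrier := {z | ∀ y ∈ A, h.mod z ⊓ h.mod y = 0}
  zero_mem' := fun y _ => by rw [h.mod_zero]; exact inf_eq_left.2 (h.mod_nonneg y)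
  add_mem' := fun {z w} hz hw y hy =>
    inf_eq_zero_of_le (h.mod_nonneg _) (h.mod_nonneg _) (h.mod_add_le z w) le_rfl
      (add_inf_eq_zero (h.mod_nonneg z) (h.mod_nonneg w) (h.mod_nonneg y) (hz y hy) (hw y hy))
  smul_mem' := fun c z hz y hy => by
    rw [h.mod_smul]
    exact smul_inf_eq_zero (norm_nonneg c) (h.mod_nonneg z) (h.mod_nonneg y) (hz y hy)

theorem mem_disjointCompl {A : Set E} {z : E} :
    z ∈ h.disjointCompl A ↔ ∀ y ∈ A, h.mod z ⊓ h.mod y = 0 := Iff.rfl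

theorem isClosedIdeal_disjointCompl (A : Set E) : IsClosedIdeal 𝕜 P (h.disjointCompl A) := by
  refine h.isClosedIdeal_of_mod_le ?_ fun x hx y hyx z hz =>
    inf_eq_zero_of_le (h.mod_nonneg _) (h.mod_nonneg _) hyx le_rfl (hx z hz)
  have : ((h.disjointCompl A : Submodule 𝕜 E) : Set E) =
      ⋂ y ∈ A, (fun z => h.mod z ⊓ h.mod y) ⁻¹' {0} := by
    ext z; simp [mem_disjointCompl]
  rw [this]
  exact isClosed_biInter fun y _ =>
    isClosed_singleton.preimage (lipschitzWith_mod.continuous.inf continuous_const)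

variable {h hW}

/-- Closed ideals determine disjointness. -/
theorem disjoint_of_closedIdeals
    (hJ : ∀ J : Submodule 𝕜 E, IsClosedIdeal 𝕜 P J → IsClosedIdeal 𝕜 W J) {x y : E}
    (hxy : h.mod x ⊓ h.mod y = 0) : hW.mod x ⊓ hW.mod y = 0 := by
  -- `x` lies in `A`, `y` in `B`, and `A` meets `B` only in zero. Both are also ideals for `W`, so
  -- they contain the infimum of the two `W`-moduli.
  set A := h.disjointCompl {y}
  set B := h.disjointCompl (A : Set E)
  have hA := hJ A (h.isClosedIdeal_disjointCompl _)
  have hB := hJ B (h.isClosedIdeal_disjointCompl _)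
  have hxA : x ∈ A := fun z hz => by rw [Set.mem_singleton_iff.1 hz]; exact hxy
  have hyB : y ∈ B := fun z hz => by rw [inf_comm]; exact hz y rfl
  have hm0 : 0 ≤ hW.mod x ⊓ hW.mod y := le_inf (hW.mod_nonneg _) (hW.mod_nonneg _)
  have hmA : ((hW.mod x ⊓ hW.mod y : hW.realPart) : E) ∈ A := hW.mem_of_mod_le hA hxA (by
    rw [hW.mod_coe_of_nonneg hm0]; exact inf_le_left)
  have hmB : ((hW.mod x ⊓ hW.mod y : hW.realPart) : E) ∈ B := hW.mem_of_mod_le hB hyB (by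
    rw [hW.mod_coe_of_nonneg hm0]; exact inf_le_right)
  have h1 := hmB _ hmA
  rw [inf_idem, h.mod_eq_zero_iff] at h1
  exact Subtype.ext h1

/-- Additivity on the cone is needed twice: for the `W`-modulus, to obtain `T`, and then for `|T
·|`. The latter is band preserving because the disjoint complement of `y` is also a `W`-ideal: if it
contains `x`, it contains `|x|_W = T x`. -/
theorem exists_clm_of_closedIdeals_iff
    (hJ : ∀ J : Submodule 𝕜 E, IsClosedIdeal 𝕜 P J ↔ IsClosedIdeal 𝕜 W J) :
    ∃ T : E →L[𝕜] E, (∀ x : h.realPart, 0 ≤ x → T x = hW.mod (x : E)) ∧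
      ∀ x : h.realPart, 0 ≤ x → h.mod (T x) = x := by
  have hadd : ∀ x y : h.realPart, 0 ≤ x → 0 ≤ y →
      hW.mod ((x + y : h.realPart) : E) = hW.mod (x : E) + hW.mod (y : E) := fun x y hx hy => by
    refine mod_map_add (A := fun x : h.realPart => (x : E)) (C := 1) (fun _ _ _ _ => rfl)
      (fun x _ => by rw [one_mul]; rfl) (fun x y hx hy hxy => ?_) hx hy
    refine disjoint_of_closedIdeals (fun J => (hJ J).1) (h := h) ?_
    rwa [h.mod_coe_of_nonneg hx, h.mod_coe_of_nonneg hy]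
  have hnorm : ∀ x : h.realPart, ‖(hW.mod (x : E) : E)‖ = ‖x‖ := fun x => by
    rw [norm_coe, hW.norm_mod]; rfl
  obtain ⟨T, hT⟩ := h.exists_clm (f := fun x => (hW.mod (x : E) : E)) (C := 1)
    (fun x y hx hy => by rw [hadd x y hx hy, AddSubgroup.coe_add])
    (fun x _ => by rw [one_mul, hnorm])
  have hband : ∀ x y : h.realPart, 0 ≤ x → 0 ≤ y → x ⊓ y = 0 → h.mod (T x) ⊓ y = 0 := by
    intro x y hx hy hxy
    have hcl := (hJ _).1 (h.isClosedIdeal_disjointCompl {(y : E)})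
    have hxm : (x : E) ∈ h.disjointCompl {(y : E)} := fun z hz => by
      rw [Set.mem_singleton_iff.1 hz, h.mod_coe_of_nonneg hx, h.mod_coe_of_nonneg hy, hxy]
    have h1 : T x ∈ h.disjointCompl {(y : E)} := hW.mem_of_mod_le hcl hxm (by
      rw [hT x hx, hW.mod_coe_of_nonneg (hW.mod_nonneg _)])
    have h2 := h1 _ rfl
    rwa [h.mod_coe_of_nonneg hy] at h2
  refine ⟨T, hT, fun x hx => ?_⟩
  refine map_eq_self_of_band_preserving (S := fun x : h.realPart => h.mod (T x)) ?_
    (fun x _ => h.mod_nonneg _) (fun x hx => ?_) hband hx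
  · intro x y hx hy
    refine mod_map_add (A := fun x : h.realPart => T x) (C := 1) (fun x y _ _ => by
      rw [AddSubgroup.coe_add, map_add]) (fun x hx => ?_) (fun x y hx hy hxy => ?_) hx hy
    · rw [one_mul, hT x hx, hnorm]
    · have h1 := hband x y hx hy hxy
      rw [inf_comm] at h1 ⊢
      exact hband y _ hy (h.mod_nonneg _) h1
  · rw [h.norm_mod, hT x hx, hnorm]

end IsBanachLatticeCone

end SameIdeals

/-! ### Operators of modulus one: local scalar approximation and invertibility. -/

section UnimodularOperators

variable {𝕜 : Type*} [RCLike 𝕜] {E : Type*} [NormedAddCommGroup E] [NormedSpace 𝕜 E] {P : Set E}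

namespace IsBanachLatticeCone

variable (h : IsBanachLatticeCone 𝕜 P)

/-- Compare `Re (d w) ≤ ‖d‖ • |w|` for `d = 1 - k² ± 2k I`, whose modulus is exactly `1 + k²`. As
`(1 + k²) - (1 - k²)² ≤ 4k²`, dividing by `2k` gives the bound. -/
theorem abs_im_le_of_le_re {w : E} {z : h.realPart} {k : ℝ} (hz : 0 ≤ z) (hk : 0 < k)
    (hk1 : k ≤ 1) (hw : h.mod w ≤ z) (hre : (1 - k ^ 2) • z ≤ h.re w) : |h.im w| ≤ (2 * k) • z := by
  by_cases hI : (RCLike.I : 𝕜) = 0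
  · rw [h.im_eq_zero_of_I_eq_zero hI, abs_zero]; exact smul_nonneg (by positivity) hz
  have key : ∀ t : ℝ, t ^ 2 = (2 * k) ^ 2 → -(t • h.im w) ≤ (4 * k ^ 2) • z := by
    intro t ht
    set d : 𝕜 := ((1 - k ^ 2 : ℝ) : 𝕜) + (t : 𝕜) * RCLike.I with hd
    have hdre : RCLike.re d = 1 - k ^ 2 := by
      rw [hd, map_add, RCLike.ofReal_re, RCLike.re_ofReal_mul, RCLike.I_re, mul_zero, add_zero]
    have hdim : RCLike.im d = t := by
      rw [hd, map_add, RCLike.ofReal_im, RCLike.im_ofReal_mul, im_I_of_ne_zero hI, mul_one, zero_add]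
    have hdn : ‖d‖ = 1 + k ^ 2 := by
      have h1 := RCLike.norm_sq_eq_def (z := d)
      rw [hdre, hdim] at h1
      have h2 : ‖d‖ ^ 2 = (1 + k ^ 2) ^ 2 := by rw [h1]; linear_combination ht
      exact (pow_left_inj₀ (norm_nonneg d) (by positivity) two_ne_zero).1 h2
    have h1 := h.re_le_mod (d • w)
    rw [h.mod_smul, h.re_smul, hdn, hdre, hdim] at h1
    have h2 := h1.trans (smul_le_smul_of_nonneg_left hw (by positivity))
    have h3 := smul_le_smul_of_nonneg_left hre (by nlinarith : 0 ≤ 1 - k ^ 2)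
    have h4 : -(t • h.im w) ≤ (1 + k ^ 2) • z - (1 - k ^ 2) • (1 - k ^ 2) • z := by
      rw [sub_le_iff_le_add, ← sub_le_iff_le_add'] at h2
      rw [neg_le_sub_iff_le_add]
      refine h3.trans ?_
      rw [add_comm]
      exact sub_le_iff_le_add'.1 (by simpa [add_comm] using h2)
    refine h4.trans ?_
    rw [smul_smul, ← sub_smul]
    refine smul_le_smul_of_nonneg_right ?_ hz
    nlinarith [pow_pos hk 4]
  have key2 : ∀ σ : ℝ, σ ^ 2 = 1 → -(σ • h.im w) ≤ (2 * k) • z := by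
    intro σ hσ
    have h1 := key (σ * (2 * k)) (by rw [mul_pow, hσ, one_mul])
    have h2 := smul_le_smul_of_nonneg_left h1 (by positivity : 0 ≤ (2 * k)⁻¹)
    have h3 : (2 * k)⁻¹ * (σ * (2 * k)) = σ := by field_simp
    have h4 : (2 * k)⁻¹ * (4 * k ^ 2) = 2 * k := by field_simp; norm_num
    rwa [smul_neg, smul_smul, smul_smul, h3, h4] at h2
  refine abs_le'.2 ⟨?_, ?_⟩
  · simpa using key2 (-1) (by norm_num)
  · simpa using key2 1 (by norm_num)

variable {T : E →L[𝕜] E} (hT : ∀ x : h.realPart, 0 ≤ x → h.mod (T x) = x)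

include hT

theorem mod_smul_map_of_mod_map {c : 𝕜} (hc : ‖c‖ = 1) (x : h.realPart) (hx : 0 ≤ x) :
    h.mod ((c • T) x) = x := by
  rw [_root_.smul_apply, h.mod_smul_of_norm_eq_one hc, hT x hx]

/-- An operator of modulus one is close to a scalar on a nonzero order interval below any given
nonzero positive vector. -/
theorem exists_mod_smul_map_sub_le {x : h.realPart} (hx : 0 ≤ x) (hx0 : x ≠ 0) {δ : ℝ}
    (hδ : 0 < δ) : ∃ c : 𝕜, ‖c‖ = 1 ∧ ∃ y : h.realPart, 0 ≤ y ∧ y ≠ 0 ∧ y ≤ x ∧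
      ∀ z : h.realPart, 0 ≤ z → z ≤ y → h.mod (c • T z - z) ≤ δ • z := by
  -- The final error is `k² + 2k`, at most `3k` because `k ≤ 1`.
  obtain ⟨k, hk, hk1, hkδ⟩ : ∃ k : ℝ, 0 < k ∧ k ≤ 1 ∧ 3 * k ≤ δ :=
    ⟨min 1 (δ / 3), by positivity, min_le_left _ _, by
      have := min_le_right 1 (δ / 3); linarith⟩
  have hk2 : 0 ≤ 1 - k ^ 2 := by nlinarith
  -- Since `x = |T x|` is the supremum of the `Re (c T x)`, the smaller vector `(1 - k²) • x` is not
  -- an upper bound.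
  obtain ⟨c, hc, hcx⟩ : ∃ c : 𝕜, ‖c‖ = 1 ∧ ¬ h.re (c • T x) ≤ (1 - k ^ 2) • x := by
    by_contra! hcon
    have h1 := h.mod_le hcon
    rw [hT x hx, sub_smul, one_smul, le_sub_self_iff] at h1
    have h2 : x ≤ 0 := by
      have := smul_le_smul_of_nonneg_left h1 (by positivity : 0 ≤ (k ^ 2)⁻¹)
      rwa [smul_smul, inv_mul_cancel₀ (by positivity), one_smul, smul_zero] at this
    exact hx0 (le_antisymm h2 hx)
  have hTc : ∀ z : h.realPart, 0 ≤ z → h.mod (c • T z) = z := fun z hz => by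
    rw [h.mod_smul_of_norm_eq_one hc, hT z hz]
  have hle : ∀ z : h.realPart, 0 ≤ z → |h.re (c • T z) - (1 - k ^ 2) • z| ≤ (2 : ℝ) • z := by
    intro z hz
    refine (abs_sub_le_abs_add_abs _ _).trans ?_
    rw [two_smul, abs_of_nonneg (smul_nonneg hk2 hz)]
    refine add_le_add ((h.abs_re_le_mod _).trans (hTc z hz).le) ?_
    exact smul_le_of_le_one_left hz (by nlinarith)
  obtain ⟨y, hy0, hyne, hyx, hy⟩ := exists_forall_nonneg_of_not_nonpos
    (A := fun z : h.realPart => h.re (c • T z) - (1 - k ^ 2) • z) (x := x)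
    (fun x y _ _ => by
      rw [AddSubgroup.coe_add, map_add, smul_add, h.re_add, smul_add, add_sub_add_comm])
    (fun z hz => norm_le_of_abs_le_smul zero_le_two (hle z hz))
    (abs_inf_eq_zero_of_abs_le_smul zero_le_two hle) hx (by rwa [sub_nonpos])
  refine ⟨c, hc, y, hy0, hyne, hyx, fun z hz hzy => ?_⟩
  have hre : (1 - k ^ 2) • z ≤ h.re (c • T z) := sub_nonneg.1 (hy z hz hzy)
  have him := h.abs_im_le_of_le_re hz hk hk1 (hTc z hz).le hre
  have hre2 : h.re (c • T z) ≤ z := (h.re_le_mod _).trans (hTc z hz).le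
  refine (h.mod_le_abs_re_add_abs_im _).trans ?_
  rw [h.re_sub, h.im_sub, h.re_coe, h.im_coe, sub_zero, abs_of_nonpos (sub_nonpos.2 hre2), neg_sub]
  calc z - h.re (c • T z) + |h.im (c • T z)| ≤ (z - (1 - k ^ 2) • z) + (2 * k) • z :=
        add_le_add (sub_le_sub_left hre _) him
    _ = (k ^ 2 + 2 * k) • z := by rw [sub_smul, add_smul, one_smul, sub_sub_cancel]
    _ ≤ δ • z := smul_le_smul_of_nonneg_right (by nlinarith) hz

/-- If `Re (T z)` exceeded `(1 + ε) • |z|`, then below the excess `w` there would be a nonzero `y`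
on whose order interval `T` is nearly a scalar. The part of `c T z - z` beyond `ε • |z|` is disjoint
from `y` and yet dominates `w`, hence `y`. -/
theorem re_map_le_mod (z : E) : h.re (T z) ≤ h.mod z := by
  set u := h.mod z with hu
  have hu0 : 0 ≤ u := h.mod_nonneg z
  refine sub_nonpos.1 (nonpos_of_forall_pos_le_smul (b := u) fun ε hε => ?_)
  by_contra hcon
  set w := (h.re (T z) - u - ε • u)⁺ with hw
  have hwne : w ≠ 0 := fun h0 => hcon (sub_nonpos.1 (posPart_eq_zero.1 h0))
  obtain ⟨c, hc, y, hy0, hyne, hyw, hy⟩ :=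
    h.exists_mod_smul_map_sub_le hT (posPart_nonneg _) hwne (half_pos hε)
  set V : E →L[𝕜] E := c • T - 1 with hV
  have hVz : ∀ z, V z = c • T z - z := fun _ => rfl
  have hV2 : ∀ x : h.realPart, 0 ≤ x → h.mod (V x) ≤ (2 : ℝ) • x := fun x hx => by
    rw [hVz, two_smul]
    refine (h.mod_sub_le _ _).trans ?_
    rw [h.mod_smul_of_norm_eq_one hc, hT x hx, h.mod_coe_of_nonneg hx]
  let A : h.realPart → h.realPart := fun x => h.mod (V x) - (ε / 2) • x
  have hAadd : ∀ x y, 0 ≤ x → 0 ≤ y → A (x + y) = A x + A y := fun x y hx hy => by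
    have := mod_map_add_of_mod_le (A := fun x : h.realPart => V x) zero_le_two
      (fun x y _ _ => by rw [AddSubgroup.coe_add, map_add]) hV2 hx hy
    simp only [A]
    rw [this, smul_add, add_sub_add_comm]
  have hAle : ∀ x, 0 ≤ x → |A x| ≤ (2 + ε / 2) • x := fun x hx => by
    refine (abs_sub_le_abs_add_abs _ _).trans ?_
    rw [abs_of_nonneg (h.mod_nonneg _), abs_of_nonneg (smul_nonneg (by positivity) hx), add_smul]
    exact add_le_add_left (hV2 x hx) _
  have hM : 0 ≤ 2 + ε / 2 := by positivity
  have hband := abs_inf_eq_zero_of_abs_le_smul hM hAle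
  have hNadd : ∀ x y, 0 ≤ x → 0 ≤ y → (A (x + y))⁺ = (A x)⁺ + (A y)⁺ := fun x y hx hy =>
    posPart_map_add_of_band_preserving hAadd (fun x hx => norm_le_of_abs_le_smul hM (hAle x hx))
      hband hx hy
  have hNy : (A y)⁺ = 0 := posPart_eq_zero.2 (sub_nonpos.2 (hy y hy0 le_rfl))
  -- The excess `(A ·)⁺` is additive and vanishes at `y`, so all its values are disjoint from `y`.
  have hN0 : ∀ a, 0 ≤ a → (A a)⁺ ⊓ y = 0 := fun a ha => by
    refine map_inf_eq_zero_of_map_eq_zero (N := fun x => (A x)⁺) (K := 2) hNadd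
      (fun x _ => posPart_nonneg _) (fun x hx => ?_) hy0 hNy ha
    have h1 := hV2 x hx
    rw [two_smul, ← two_nsmul] at h1
    exact sup_le ((sub_le_self _ (smul_nonneg (by positivity) hx)).trans h1) (nsmul_nonneg hx 2)
  have hVa : ∀ a : h.realPart, 0 ≤ a → h.mod (V a) ≤ (ε / 2) • a + (A a)⁺ := fun a ha => by
    rw [← sub_le_iff_le_add']; exact le_posPart (A a)
  have hVreal : ∀ a : h.realPart, h.mod (V a) ≤ (ε / 2) • |a| + ((A a⁺)⁺ + (A a⁻)⁺) := fun a => by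
    conv_lhs => rw [← posPart_sub_negPart a, AddSubgroup.coe_sub, map_sub]
    refine (h.mod_sub_le _ _).trans ((add_le_add (hVa _ (posPart_nonneg a))
      (hVa _ (negPart_nonneg a))).trans_eq ?_)
    rw [add_add_add_comm, ← smul_add, posPart_add_negPart]
  have hVI : ∀ a : h.realPart, h.mod ((RCLike.I : 𝕜) • V a) ≤ h.mod (V a) := fun a => by
    rw [h.mod_smul]
    refine smul_le_of_le_one_left (h.mod_nonneg _) ?_
    rw [RCLike.norm_I]; split_ifs <;> norm_num
  set g₁ := (A (h.re z)⁺)⁺ + (A (h.re z)⁻)⁺ with hg₁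
  set g₂ := (A (h.im z)⁺)⁺ + (A (h.im z)⁻)⁺ with hg₂
  have hg₁0 : 0 ≤ g₁ := add_nonneg (posPart_nonneg _) (posPart_nonneg _)
  have hg₂0 : 0 ≤ g₂ := add_nonneg (posPart_nonneg _) (posPart_nonneg _)
  have hVzle : h.mod (V z) ≤ ε • u + (g₁ + g₂) := by
    conv_lhs => rw [← h.re_add_im z, map_add, map_smul]
    refine (h.mod_add_le _ _).trans ((add_le_add (hVreal _) ((hVI _).trans (hVreal _))).trans ?_)
    rw [add_add_add_comm]
    refine add_le_add_left ?_ _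
    have hεu : ε • u = (ε / 2) • u + (ε / 2) • u := by rw [← add_smul, add_halves]
    rw [hεu]
    exact add_le_add (smul_le_smul_of_nonneg_left (h.abs_re_le_mod z) (by positivity))
      (smul_le_smul_of_nonneg_left (h.abs_im_le_mod z) (by positivity))
  have hwle : w ≤ g₁ + g₂ := by
    refine sup_le ?_ (add_nonneg hg₁0 hg₂0)
    rw [sub_le_iff_le_add', sub_le_iff_le_add']
    calc h.re (T z) ≤ h.mod (T z) := h.re_le_mod _
      _ = h.mod (z + V z) := by
          rw [hVz, add_sub_cancel, h.mod_smul_of_norm_eq_one hc]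
      _ ≤ u + h.mod (V z) := h.mod_add_le _ _
      _ ≤ _ := by gcongr
  refine hyne (eq_zero_of_le_of_inf_eq_zero hy0 (hyw.trans hwle) le_rfl ?_)
  refine add_inf_eq_zero hg₁0 hg₂0 hy0 ?_ ?_ <;>
    exact add_inf_eq_zero (posPart_nonneg _) (posPart_nonneg _) hy0
      (hN0 _ (posPart_nonneg _)) (hN0 _ (negPart_nonneg _))

/-- An operator of modulus one does not increase absolute values. -/
theorem mod_map_le_mod (z : E) : h.mod (T z) ≤ h.mod z :=
  h.mod_le fun _ hc => h.re_map_le_mod (h.mod_smul_map_of_mod_map hT hc) z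

omit hT

/-- The conjugate of a vector. -/
noncomputable def conj (z : E) : E := (h.re z : E) - (RCLike.I : 𝕜) • (h.im z : E)

theorem re_im_conj (z : E) : h.re (h.conj z) = h.re z ∧ h.im (h.conj z) = -h.im z :=
  h.re_im_unique (by rw [conj, AddSubgroup.coe_neg, smul_neg, ← sub_eq_add_neg]) (fun hI => by
    rw [h.im_eq_zero_of_I_eq_zero hI, neg_zero])

theorem eq_of_re_eq_of_im_eq {z w : E} (hre : h.re z = h.re w) (him : h.im z = h.im w) : z = w := by
  rw [← h.re_add_im z, ← h.re_add_im w, hre, him]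

theorem conj_add (z w : E) : h.conj (z + w) = h.conj z + h.conj w :=
  h.eq_of_re_eq_of_im_eq
    (by rw [h.re_add, (h.re_im_conj _).1, (h.re_im_conj _).1, (h.re_im_conj _).1, h.re_add])
    (by rw [h.im_add, (h.re_im_conj _).2, (h.re_im_conj _).2, (h.re_im_conj _).2, h.im_add,
      neg_add])

theorem conj_smul (c : 𝕜) (z : E) : h.conj (c • z) = (starRingEnd 𝕜 c) • h.conj z :=
  h.eq_of_re_eq_of_im_eq
    (by rw [h.re_smul, (h.re_im_conj _).1, (h.re_im_conj _).1, (h.re_im_conj _).2, h.re_smul,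
      RCLike.conj_re, RCLike.conj_im, neg_smul_neg])
    (by rw [h.im_smul, (h.re_im_conj _).2, (h.re_im_conj _).1, (h.re_im_conj _).2, h.im_smul,
      RCLike.conj_re, RCLike.conj_im, smul_neg, neg_smul, neg_add])

theorem conj_conj (z : E) : h.conj (h.conj z) = z :=
  h.eq_of_re_eq_of_im_eq (by rw [(h.re_im_conj _).1, (h.re_im_conj _).1])
    (by rw [(h.re_im_conj _).2, (h.re_im_conj _).2, neg_neg])

theorem mod_conj (z : E) : h.mod (h.conj z) = h.mod z := by
  have key : ∀ w, h.mod (h.conj w) ≤ h.mod w := fun w => h.mod_le fun c hc => by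
    have h1 : c • h.conj w = h.conj ((starRingEnd 𝕜 c) • w) := by
      rw [h.conj_smul, RingHomCompTriple.comp_apply, RingHom.id_apply]
    rw [h1, (h.re_im_conj _).1]
    exact h.re_smul_le_mod (by rwa [RCLike.norm_conj]) w
  refine le_antisymm (key z) ?_
  simpa [h.conj_conj] using key (h.conj z)

theorem conj_sub_coe (z : E) (x : h.realPart) : h.conj (z - x) = h.conj z - x :=
  h.eq_of_re_eq_of_im_eq
    (by rw [h.re_sub, (h.re_im_conj _).1, (h.re_im_conj _).1, h.re_sub])
    (by rw [h.im_sub, (h.re_im_conj _).2, (h.re_im_conj _).2, h.im_sub, h.im_coe, sub_zero,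
      sub_zero])

/-- If `R = S T - 1` were nonzero, `|R v| ≥ η • v` would hold on a nonzero order interval. Inside
it, `T` is close to the scalar with inverse `c`, so `S` is close to `c` there, and `|R v| ≤ (η / 2)
• v` for some `v ≠ 0`. -/
theorem comp_eq_one_of_eq_conj {S : E →L[𝕜] E}
    (hT : ∀ x : h.realPart, 0 ≤ x → h.mod (T x) = x)
    (hS : ∀ x : h.realPart, 0 ≤ x → S x = h.conj (T x)) : S ∘L T = 1 := by
  have hSmod : ∀ x : h.realPart, 0 ≤ x → h.mod (S x) = x := fun x hx => by
    rw [hS x hx, h.mod_conj, hT x hx]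
  refine h.clm_ext fun x hx => ?_
  set R : E →L[𝕜] E := S ∘L T - 1 with hR
  have hRz : ∀ z, R z = S (T z) - z := fun _ => rfl
  have hR2 : ∀ x : h.realPart, 0 ≤ x → h.mod (R x) ≤ (2 : ℝ) • x := fun x hx => by
    rw [hRz, two_smul]
    refine (h.mod_sub_le _ _).trans ?_
    rw [h.mod_coe_of_nonneg hx]
    exact add_le_add_left ((h.mod_map_le_mod hSmod _).trans (hT x hx).le) _
  suffices hle : h.mod (R x) ≤ 0 by
    have := h.mod_eq_zero_iff.1 (le_antisymm hle (h.mod_nonneg _))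
    exact sub_eq_zero.1 this
  refine nonpos_of_forall_pos_le_smul (b := x) fun η hη => ?_
  by_contra hcon
  have hM : 0 ≤ 2 + η := by positivity
  have hAle : ∀ x : h.realPart, 0 ≤ x → |h.mod (R x) - η • x| ≤ (2 + η) • x := fun x hx => by
    refine (abs_sub_le_abs_add_abs _ _).trans ?_
    rw [abs_of_nonneg (h.mod_nonneg _), abs_of_nonneg (smul_nonneg hη.le hx), add_smul]
    exact add_le_add_left (hR2 x hx) _
  obtain ⟨y, hy0, hyne, -, hy⟩ := exists_forall_nonneg_of_not_nonpos
    (A := fun x : h.realPart => h.mod (R x) - η • x) (x := x)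
    (fun x y hx hy => by
      have := mod_map_add_of_mod_le (A := fun x : h.realPart => R x) zero_le_two
        (fun x y _ _ => by rw [AddSubgroup.coe_add, map_add]) hR2 hx hy
      rw [this, smul_add, add_sub_add_comm])
    (fun x hx => norm_le_of_abs_le_smul hM (hAle x hx))
    (abs_inf_eq_zero_of_abs_le_smul hM hAle) hx (by rwa [sub_nonpos])
  obtain ⟨c, hc, v, hv0, hvne, hvy, hv⟩ :=
    h.exists_mod_smul_map_sub_le hT hy0 hyne (by positivity : 0 < η / 4)
  have hc' : ‖starRingEnd 𝕜 c‖ = 1 := by rwa [RCLike.norm_conj]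
  have hcc : starRingEnd 𝕜 c * c = 1 := by
    rw [RCLike.conj_mul, hc]; simp
  have h1 := hv v hv0 le_rfl
  -- `S` equals the conjugate of `T` on `v`, so the terms with `S v` cancel and both summands are
  -- controlled by `c T v - v`.
  have h2 : R v = S ((starRingEnd 𝕜 c) • (c • T v - v)) + h.conj (c • T v - v) := by
    rw [h.conj_sub_coe, h.conj_smul, ← hS v hv0, smul_sub, smul_smul, hcc, one_smul, map_sub,
      map_smul, hRz]
    abel
  have h3 : h.mod (R v) ≤ (η / 2) • v := by
    rw [h2]
    refine (h.mod_add_le _ _).trans ?_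
    rw [h.mod_conj, show η / 2 = η / 4 + η / 4 by ring, add_smul]
    refine add_le_add ((h.mod_map_le_mod hSmod _).trans ?_) h1
    rwa [h.mod_smul_of_norm_eq_one hc']
  have h4 : η • v ≤ h.mod (R v) := sub_nonneg.1 (hy v hv0 hvy)
  have h5 : (η / 2) • v ≤ 0 := by
    have := h4.trans h3
    rwa [← sub_nonpos, ← sub_smul, sub_half] at this
  have h6 := smul_le_smul_of_nonneg_left h5 (by positivity : 0 ≤ (η / 2)⁻¹)
  rw [smul_smul, inv_mul_cancel₀ (by positivity), one_smul, smul_zero] at h6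
  exact hvne (le_antisymm h6 hv0)

/-- An operator of modulus one is invertible and preserves absolute values. -/
theorem exists_equiv_of_mod_map (hT : ∀ x : h.realPart, 0 ≤ x → h.mod (T x) = x) :
    ∃ e : E ≃L[𝕜] E, (∀ z, e z = T z) ∧ ∀ z, h.mod (e z) = h.mod z := by
  obtain ⟨S, hS⟩ := h.exists_clm (f := fun x => h.conj (T x)) (C := 1)
    (fun x y _ _ => by rw [AddSubgroup.coe_add, map_add, h.conj_add])
    (fun x hx => by rw [← h.norm_mod, h.mod_conj, hT x hx, one_mul])
  have hSmod : ∀ x : h.realPart, 0 ≤ x → h.mod (S x) = x := fun x hx => by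
    rw [hS x hx, h.mod_conj, hT x hx]
  have hST := h.comp_eq_one_of_eq_conj hT hS
  have hTS := h.comp_eq_one_of_eq_conj hSmod (S := T) (fun x hx => by rw [hS x hx, h.conj_conj])
  have hST' : ∀ z, S (T z) = z := fun z => DFunLike.congr_fun hST z
  have hTS' : ∀ z, T (S z) = z := fun z => DFunLike.congr_fun hTS z
  refine ⟨ContinuousLinearEquiv.equivOfInverse T S hST' hTS', fun _ => rfl, fun z => ?_⟩
  refine le_antisymm (h.mod_map_le_mod hT z) ?_
  have := h.mod_map_le_mod hSmod (T z)
  rwa [hST'] at this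

end IsBanachLatticeCone

end UnimodularOperators

/-! ### Transport of cones and ideals along an isomorphism. -/

section Transport

variable {𝕜 : Type*} [RCLike 𝕜] {E : Type*} [NormedAddCommGroup E] [NormedSpace 𝕜 E] {P : Set E}
  (e : E ≃L[𝕜] E)

theorem coneLE_image_iff {x y : E} : ConeLE (e '' P) (e x) (e y) ↔ ConeLE P x y := by
  rw [ConeLE, ← map_sub, e.injective.mem_set_image]; rfl

theorem image_realVectors : realVectors (e '' P) = e '' realVectors P := by
  ext x
  constructor
  · rintro ⟨_, ⟨a, ha, rfl⟩, _, ⟨b, hb, rfl⟩, rfl⟩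
    exact ⟨a - b, ⟨a, ha, b, hb, rfl⟩, map_sub _ _ _⟩
  · rintro ⟨_, ⟨a, ha, b, hb, rfl⟩, rfl⟩
    exact ⟨_, ⟨a, ha, rfl⟩, _, ⟨b, hb, rfl⟩, map_sub _ _ _⟩

theorem isConeSup_image_iff {A : Set E} {s : E} :
    IsConeSup (e '' P) (e '' A) (e s) ↔ IsConeSup P A s := by
  refine and_congr ?_ ?_
  · rw [Set.forall_mem_image]
    exact forall₂_congr fun x _ => coneLE_image_iff e
  · rw [e.surjective.forall]
    refine forall_congr' fun t => ?_
    rw [Set.forall_mem_image, coneLE_image_iff]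
    exact imp_congr (forall₂_congr fun x _ => coneLE_image_iff e) Iff.rfl

theorem image_rotatedRealParts (z : E) :
    rotatedRealParts 𝕜 (e '' P) (e z) = e '' rotatedRealParts 𝕜 P z := by
  ext x
  constructor
  · rintro ⟨hx, c, hc, y, hy, hz⟩
    rw [image_realVectors] at hx hy
    obtain ⟨x, hx, rfl⟩ := hx
    obtain ⟨y, hy, rfl⟩ := hy
    exact ⟨x, ⟨hx, c, hc, y, hy, e.injective (by simpa using hz)⟩, rfl⟩
  · rintro ⟨x, ⟨hx, c, hc, y, hy, hz⟩, rfl⟩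
    rw [rotatedRealParts, image_realVectors]
    exact ⟨⟨x, hx, rfl⟩, c, hc, e y, ⟨y, hy, rfl⟩, by rw [← map_smul, hz, map_add, map_smul]⟩

theorem isModulus_image_iff {z m : E} : IsModulus 𝕜 (e '' P) (e z) (e m) ↔ IsModulus 𝕜 P z m := by
  rw [IsModulus, image_rotatedRealParts, isConeSup_image_iff]; rfl

variable {e}

namespace IsBanachLatticeCone

theorem image (h : IsBanachLatticeCone 𝕜 P) (he : ∀ z, ‖e z‖ = ‖z‖) :
    IsBanachLatticeCone 𝕜 (e '' P) where
  isCone :=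
    { zero_mem := ⟨0, h.isCone.zero_mem, map_zero _⟩
      add_mem := by
        rintro _ ⟨x, hx, rfl⟩ _ ⟨y, hy, rfl⟩
        exact ⟨x + y, h.isCone.add_mem x hx y hy, map_add _ _ _⟩
      smul_mem := by
        rintro r hr _ ⟨x, hx, rfl⟩
        exact ⟨_, h.isCone.smul_mem r hr x hx, map_smul _ _ _⟩
      salient := by
        rintro _ ⟨x, hx, rfl⟩ hneg
        rw [← map_neg, e.injective.mem_set_image] at hneg
        rw [h.isCone.salient x hx hneg, map_zero] }
  exists_real_imag z := by
    obtain ⟨x, hx, y, hy, hz⟩ := h.exists_real_imag (e.symm z)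
    rw [image_realVectors]
    exact ⟨e x, ⟨x, hx, rfl⟩, e y, ⟨y, hy, rfl⟩, by
      rw [← map_smul, ← map_add, ← hz, e.apply_symm_apply]⟩
  real_inf_imag := by
    rw [image_realVectors]
    rintro _ ⟨x, hx, rfl⟩ hI
    rw [← map_smul, e.injective.mem_set_image] at hI
    rw [← map_smul, h.real_inf_imag x hx hI, map_zero]
  exists_sup := by
    rw [image_realVectors]
    rintro _ ⟨x, hx, rfl⟩ _ ⟨y, hy, rfl⟩
    obtain ⟨s, hs⟩ := h.exists_sup x hx y hy
    exact ⟨e s, by rw [← Set.image_pair, isConeSup_image_iff]; exact hs⟩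
  exists_modulus z := by
    obtain ⟨m, hm, hn⟩ := h.exists_modulus (e.symm z)
    refine ⟨e m, ?_, ?_⟩
    · rw [← isModulus_image_iff e, e.apply_symm_apply] at hm
      exact hm
    · rw [he, hn, ← he, e.apply_symm_apply]
  norm_mono := by
    rintro _ ⟨x, hx, rfl⟩ _ ⟨y, hy, rfl⟩ hxy
    rw [he, he]
    exact h.norm_mono x hx y hy ((coneLE_image_iff e).1 hxy)

/-- As `e` preserves moduli, `e z ∈ J` exactly when `z ∈ J`; so the ideal condition for the image
cone pulls back to the one for `P`. -/
theorem isClosedIdeal_image (h : IsBanachLatticeCone 𝕜 P) (he : ∀ z, h.mod (e z) = h.mod z)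
    {J : Submodule 𝕜 E} (hJ : IsClosedIdeal 𝕜 P J) : IsClosedIdeal 𝕜 (e '' P) J := by
  refine ⟨hJ.1, fun x hx y mx my hmx hmy hle => ?_⟩
  obtain ⟨x, rfl⟩ := e.surjective x
  obtain ⟨y, rfl⟩ := e.surjective y
  obtain ⟨mx, rfl⟩ := e.surjective mx
  obtain ⟨my, rfl⟩ := e.surjective my
  rw [isModulus_image_iff] at hmx hmy
  rw [coneLE_image_iff] at hle
  exact h.mem_of_mod_le hJ (hJ.2 x (h.mem_of_mod_le hJ hx (he x).ge) y mx my hmx hmy hle) (he y).le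

theorem isClosedIdeal_image_iff (h : IsBanachLatticeCone 𝕜 P) (he : ∀ z, h.mod (e z) = h.mod z)
    (J : Submodule 𝕜 E) : IsClosedIdeal 𝕜 P J ↔ IsClosedIdeal 𝕜 (e '' P) J := by
  refine ⟨h.isClosedIdeal_image he, fun hJ => ?_⟩
  have hnorm : ∀ z, ‖e z‖ = ‖z‖ := fun z => by rw [← h.norm_mod, he, h.norm_mod]
  have hW : IsBanachLatticeCone 𝕜 (e '' P) := h.image hnorm
  have hmod : ∀ z, (hW.mod (e z) : E) = e (h.mod z) := fun z =>
    hW.isModulus_iff.1 ((isModulus_image_iff e).2 (h.isModulus_mod z))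
  -- The inverse of `e` takes the image cone back to `P`, and it preserves the moduli of the image
  -- cone because these are the `e`-images of the old ones.
  have h1 := hW.isClosedIdeal_image (e := e.symm) (fun w => Subtype.ext (by
    obtain ⟨z, rfl⟩ := e.surjective w
    obtain ⟨z, rfl⟩ := e.surjective z
    rw [e.symm_apply_apply, hmod, hmod, he])) hJ
  rwa [Set.image_image, funext e.symm_apply_apply, Set.image_id'] at h1

end IsBanachLatticeCone

end Transport

/-! ### Conclusion: both directions. -/

theorem theorem4 {𝕜 : Type*} [RCLike 𝕜] {E : Type*} [NormedAddCommGroup E] [NormedSpace 𝕜 E]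
    [CompleteSpace E] (P : Set E) (hP : IsBanachLatticeCone 𝕜 P) :
    (∀ W : Set E, IsBanachLatticeCone 𝕜 W →
      (∀ J : Submodule 𝕜 E, IsClosedIdeal 𝕜 P J ↔ IsClosedIdeal 𝕜 W J) →
      ∃ T : E →L[𝕜] E, T ∈ idealCenter 𝕜 P ∧ IsModulus 𝕜 (centerCone 𝕜 P) T 1 ∧
        ∀ x ∈ P, IsModulus 𝕜 W x (T x)) ∧
    (∀ T : E →L[𝕜] E, T ∈ idealCenter 𝕜 P → IsModulus 𝕜 (centerCone 𝕜 P) T 1 →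
      IsBanachLatticeCone 𝕜 (T '' P) ∧
        ∀ J : Submodule 𝕜 E, IsClosedIdeal 𝕜 P J ↔ IsClosedIdeal 𝕜 (T '' P) J) := by
  refine ⟨fun W hW hJ => ?_, fun T hT hT1 => ?_⟩
  · obtain ⟨T, hTW, hTP⟩ :=
      IsBanachLatticeCone.exists_clm_of_closedIdeals_iff (h := hP) (hW := hW) hJ
    have hTc : T ∈ idealCenter 𝕜 P := hP.mem_idealCenter_iff.2 ⟨1, one_pos, fun x hx => by
      rw [one_smul, hTP x hx]⟩
    refine ⟨T, hTc, (hP.isModulus_one_iff hTc).2 hTP, fun x hx => hW.isModulus_iff.2 ?_⟩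
    exact (hTW ⟨x, hP.mem_realVectors hx⟩ (IsBanachLatticeCone.nonneg_iff.2 hx)).symm
  · obtain ⟨e, heT, he⟩ := hP.exists_equiv_of_mod_map ((hP.isModulus_one_iff hT).1 hT1)
    have himage : T '' P = e '' P := Set.image_congr fun z _ => (heT z).symm
    rw [himage]
    exact ⟨hP.image fun z => by rw [← hP.norm_mod, he, hP.norm_mod],
      hP.isClosedIdeal_image_iff he⟩
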